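/- Let $\mathbb H$ be the quaternions and let $\mathbb P^{n}_{\mathbb H}$ be the quotient of $\mathbb H^{n+1}\setminus\{0\}$ by $z\sim z\alpha$ ($\alpha\in\mathbb H\setminus\{0\}$), with the quotient topology. The group $\mathrm{SL}(n+1,\mathbb H)$ consists of the matrices with $\det_{\mathbb H}(A_1+A_2j):=\det\begin{pmatrix}A_1&A_2\\-\overline{A_2}&\overline{A_1}\end{pmatrix}=1$ ($A_1,A_2$ complex); it acts on $\mathbb P^n_{\mathbb H}$ by left multiplication on column vectors, and this induces an action of $\mathrm{PSL}(n+1,\mathbb H)=\mathrm{SL}(n+1,\mathbb H)/\{\pm I\}$. For a group $G$ acting on a topological space $X$, a point $p$ is a cluster point of a family $(A_\beta)_{\beta\in B}$ of subsets of $X$ if every neighbourhood of $p$ meets $A_\beta$ for infinitely many $\beta$. Let $L_0(G)$ be the closure of the set of points with infinite isotropy group; $L_1(G)$ the closure of the set of cluster points of the orbits $(gx)_{g\in G}$ of points $x\in X\setminus L_0(G)$; and $L_2(G)$ the closure of the set of cluster points of the families $(gK)_{g\in G}$, where $K$ runs over the compact subsets of $X\setminus(L_0(G)\cup L_1(G))$.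 The Kulkarni limit set is $\Lambda_{Kul}(G)=L_0(G)\cup L_1(G)\cup L_2(G)$. Let $J(1,m)$ be the $m\times m$ Jordan block with $1$ on the diagonal and on the superdiagonal. Let $k,l\ge 1$, $n+1=k+l$, and let $\tilde\gamma\in\mathrm{PSL}(n+1,\mathbb H)$ have a lift $\gamma\in\mathrm{SL}(n+1,\mathbb H)$ of the block diagonal form $$\gamma=\begin{bmatrix}\lambda_1J(1,k)&\\&\lambda_2J(1,l)\end{bmatrix},\qquad \lambda_1,\lambda_2\in\mathbb H,\quad |\lambda_1|<|\lambda_2|,$$ (so that $|\lambda_1|^k|\lambda_2|^l=1$; for $k=l$ this reads $|\lambda_1||\lambda_2|=1$). Write $e_1,\dots,e_{k+l}$ for the points of $\mathbb P^n_{\mathbb H}$ given by the standard basis vectors and $L\,S$ for the projective subspace generated by a set $S$ of points. Then for $G=\langle\tilde\gamma\rangle$ acting on $\mathbb P^n_{\mathbb H}$: $$L_0(G)=L_1(G)=\{e_1,e_{k+1}\},$$ $$L_2(G)=\Lambda_{Kul}(G)=L\{e_1,\dots,e_{k-1},e_{k+1},\dots,e_{k+l}\}\ \cup\ L\{e_1,\dots,e_{k+l-1}\}.$$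 -/

import Mathlib

open Quaternion Topology Pointwise
open scoped LinearAlgebra.Projectivization

noncomputable section

namespace QuaternionicKulkarni

/-! ### Kulkarni sets of a group acting on a topological space -/

/-- `p` is a cluster point of the family `(A b)` if every neighbourhood of `p` meets `A b` for
infinitely many indices `b`. -/
def IsFamilyClusterPt {B X : Type*} [TopologicalSpace X] (A : B → Set X) (p : X) : Prop :=
  ∀ N ∈ 𝓝 p, {b : B | (N ∩ A b).Nonempty}.Infinite

section Kulkarni

variable (G X : Type*) [Group G] [TopologicalSpace X] [MulAction G X]

/-- The closure of the set of points with infinite isotropy group. -/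
def kulkarniL0 : Set X :=
  closure {x : X | Infinite (MulAction.stabilizer G x)}

/-- The closure of the set of cluster points of orbits of points outside `L₀`. -/
def kulkarniL1 : Set X :=
  closure {p : X | ∃ x : X, x ∉ kulkarniL0 G X ∧
    IsFamilyClusterPt (fun g : G => ({g • x} : Set X)) p}

/-- The closure of the set of cluster points of the families `(g K)`, where `K` runs over the
compact sets disjoint from `L₀ ∪ L₁`. -/
def kulkarniL2 : Set X :=
  closure {p : X | ∃ K : Set X, IsCompact K ∧ K ⊆ (kulkarniL0 G X ∪ kulkarniL1 G X)ᶜ ∧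
    IsFamilyClusterPt (fun g : G => g • K) p}

/-- The Kulkarni limit set. -/
def kulkarniLimitSet : Set X :=
  kulkarniL0 G X ∪ kulkarniL1 G X ∪ kulkarniL2 G X

end Kulkarni

/-! ### The groups `SL(n, ℍ)` and `PSL(n, ℍ)` -/

/-- The complex number `z₁` in the decomposition `q = z₁ + z₂ j`. -/
def cpart₁ (q : ℍ[ℝ]) : ℂ := ⟨q.re, q.imI⟩

/-- The complex number `z₂` in the decomposition `q = z₁ + z₂ j`. -/
def cpart₂ (q : ℍ[ℝ]) : ℂ := ⟨q.imJ, q.imK⟩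

lemma cpart₁_mul (p q : ℍ[ℝ]) :
    cpart₁ (p * q) = cpart₁ p * cpart₁ q + cpart₂ p * (-star (cpart₂ q)) := by
  apply Complex.ext <;> simp [cpart₁, cpart₂] <;> ring

lemma cpart₂_mul (p q : ℍ[ℝ]) :
    cpart₂ (p * q) = cpart₁ p * cpart₂ q + cpart₂ p * star (cpart₁ q) := by
  apply Complex.ext <;> simp [cpart₁, cpart₂] <;> ring

lemma cpart₁_sum {ι : Type*} (s : Finset ι) (f : ι → ℍ[ℝ]) :
    cpart₁ (∑ i ∈ s, f i) = ∑ i ∈ s, cpart₁ (f i) :=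
  map_sum (AddMonoidHom.mk' cpart₁ fun a b => by apply Complex.ext <;> simp [cpart₁]) f s

lemma cpart₂_sum {ι : Type*} (s : Finset ι) (f : ι → ℍ[ℝ]) :
    cpart₂ (∑ i ∈ s, f i) = ∑ i ∈ s, cpart₂ (f i) :=
  map_sum (AddMonoidHom.mk' cpart₂ fun a b => by apply Complex.ext <;> simp [cpart₂]) f s

/-- The embedding `A₁ + A₂ j ↦ [[A₁, A₂], [-conj A₂, conj A₁]]` of `M(n, ℍ)` into `M(2n, ℂ)`. -/
def Φ (n : ℕ) : Matrix (Fin n) (Fin n) ℍ[ℝ] →* Matrix (Fin n ⊕ Fin n) (Fin n ⊕ Fin n) ℂ where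
  toFun A := Matrix.fromBlocks (A.map cpart₁) (A.map cpart₂)
    (-(A.map fun q => star (cpart₂ q))) (A.map fun q => star (cpart₁ q))
  map_one' := by
    rw [← Matrix.fromBlocks_one]
    congr 1 <;> ext i j <;> by_cases h : i = j <;>
      simp [Matrix.one_apply, h, cpart₁, cpart₂, Complex.ext_iff]
  map_mul' A B := by
    rw [Matrix.fromBlocks_multiply]
    congr 1 <;> ext i j <;>
      simp only [Matrix.map_apply, Matrix.mul_apply, Matrix.add_apply, Matrix.neg_apply,
        cpart₁_sum, cpart₂_sum, cpart₁_mul, cpart₂_mul, star_sum, star_add, star_mul', star_neg,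
        star_star, ← Finset.sum_add_distrib, ← Finset.sum_neg_distrib] <;>
      refine Finset.sum_congr rfl fun x _ => ?_ <;> ring

/-- The quaternionic determinant `det_ℍ A = det Φ(A)`. -/
def detH (n : ℕ) : Matrix (Fin n) (Fin n) ℍ[ℝ] →* ℂ :=
  Matrix.detMonoidHom.comp (Φ n)

/-- `SL(n, ℍ)`: the invertible quaternionic matrices with `det_ℍ = 1`. -/
abbrev SL (n : ℕ) : Type :=
  ((detH n).comp (Units.coeHom (Matrix (Fin n) (Fin n) ℍ[ℝ]))).ker

/-- The underlying matrix of an element of `SL(n, ℍ)`. -/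
def SL.mat {n : ℕ} (g : SL n) : Matrix (Fin n) (Fin n) ℍ[ℝ] :=
  ((g : (Matrix (Fin n) (Fin n) ℍ[ℝ])ˣ) : Matrix (Fin n) (Fin n) ℍ[ℝ])

/-- The central subgroup `{I, -I}` of `SL(n, ℍ)`. -/
def pmOne (n : ℕ) : Subgroup (SL n) where
  carrier := {g | g.mat = 1 ∨ g.mat = -1}
  one_mem' := Or.inl rfl
  mul_mem' := by
    rintro a b ha hb
    have h : (a * b).mat = a.mat * b.mat := rfl
    rcases ha with ha | ha <;> rcases hb with hb | hb <;> simp [h, ha, hb]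
  inv_mem' := by
    rintro a ha
    have h : (a⁻¹).mat * a.mat = 1 := Units.inv_mul (a : (Matrix (Fin n) (Fin n) ℍ[ℝ])ˣ)
    rcases ha with ha | ha
    · exact Or.inl (by simpa [ha] using h)
    · exact Or.inr (by simpa [ha, neg_eq_iff_eq_neg] using h)

instance (n : ℕ) : (pmOne n).Normal where
  conj_mem a ha g := by
    have h : (g * a * g⁻¹).mat = g.mat * a.mat * (g⁻¹).mat := rfl
    have h' : g.mat * (g⁻¹).mat = 1 := Units.mul_inv (g : (Matrix (Fin n) (Fin n) ℍ[ℝ])ˣ)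
    rcases ha with ha | ha
    · exact Or.inl (by simp [h, ha, h'])
    · exact Or.inr (by simp [h, ha, h'])

/-- `PSL(n, ℍ) = SL(n, ℍ) / {I, -I}`. -/
abbrev PSL (n : ℕ) : Type := SL n ⧸ pmOne n

/-! ### Quaternionic projective space -/

/-- The projective space of the right `ℍ`-module `ℍⁿ` (of quaternionic dimension `n - 1`): nonzero
vectors modulo `z ∼ z α`. A right `ℍ`-module is a left module over `ℍᵐᵒᵖ`. -/
abbrev HP (n : ℕ) : Type := ℙ ℍ[ℝ]ᵐᵒᵖ (Fin n → ℍ[ℝ])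

/-- The quotient topology. -/
instance (n : ℕ) : TopologicalSpace (HP n) :=
  inferInstanceAs (TopologicalSpace
    (Quotient (projectivizationSetoid ℍ[ℝ]ᵐᵒᵖ (Fin n → ℍ[ℝ]))))

/-- The action of `SL(n, ℍ)` on column vectors is multiplication from the left. -/
lemma SL.smul_def {n : ℕ} (g : SL n) (v : Fin n → ℍ[ℝ]) : g • v = g.mat.mulVec v := rfl

/-- The action is linear for the right module structure. With this, Mathlib provides the induced
action `γ (ℙ z) = ℙ (γ z)` of `SL(n, ℍ)` on projective space. -/
instance (n : ℕ) : SMulCommClass (SL n) ℍ[ℝ]ᵐᵒᵖ (Fin n → ℍ[ℝ]) where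
  smul_comm g a v := Matrix.mulVec_smul g.mat a v

lemma pmOne_le_ker (n : ℕ) : pmOne n ≤ (MulAction.toPermHom (SL n) (HP n)).ker := by
  intro g hg
  rw [MonoidHom.mem_ker]
  ext x
  induction x using Projectivization.ind with
  | h v hv =>
    change Projectivization.mk ℍ[ℝ]ᵐᵒᵖ (g • v) ((smul_ne_zero_iff_ne g).mpr hv) =
      Projectivization.mk ℍ[ℝ]ᵐᵒᵖ v hv
    rw [Projectivization.mk_eq_mk_iff']
    rcases hg with hg | hg
    · exact ⟨1, by simp [SL.smul_def, hg]⟩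
    · exact ⟨-1, by simp [SL.smul_def, hg, Matrix.neg_mulVec]⟩

/-- The induced action of `PSL(n, ℍ)` on projective space. -/
instance (n : ℕ) : MulAction (PSL n) (HP n) :=
  MulAction.compHom (HP n)
    (QuotientGroup.lift (pmOne n) (MulAction.toPermHom (SL n) (HP n)) (pmOne_le_ker n))

lemma PSL.mk_smul_mk {n : ℕ} (g : SL n) (v : Fin n → ℍ[ℝ]) (hv : v ≠ 0) :
    (g : PSL n) • Projectivization.mk ℍ[ℝ]ᵐᵒᵖ v hv =
      Projectivization.mk ℍ[ℝ]ᵐᵒᵖ (g.mat.mulVec v) ((smul_ne_zero_iff_ne g).mpr hv) := rfl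

/-- The point of projective space given by the `i`-th standard basis vector. The index starts
at `0`, so `e i` is the point usually denoted `e_{i+1}`. -/
def e {n : ℕ} (i : Fin n) : HP n :=
  Projectivization.mk ℍ[ℝ]ᵐᵒᵖ (Pi.single i 1 : Fin n → ℍ[ℝ]) (by simp)

/-- The projective subspace `L S` generated by a set `S` of points. -/
def L {n : ℕ} (S : Set (HP n)) : Set (HP n) := (Projectivization.Subspace.span S : Set (HP n))

/-! ### Jordan blocks -/

/-- The Jordan block `J(c, m)`: `c` on the diagonal, `1` on the superdiagonal. -/
def J (c : ℍ[ℝ]) (m : ℕ) : Matrix (Fin m) (Fin m) ℍ[ℝ] :=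
  Matrix.of fun i j => if i = j then c else if (i : ℕ) + 1 = j then 1 else 0

/-- The block diagonal matrix with blocks `A` and `B`. -/
def blockDiag {k l : ℕ} (A : Matrix (Fin k) (Fin k) ℍ[ℝ]) (B : Matrix (Fin l) (Fin l) ℍ[ℝ]) :
    Matrix (Fin (k + l)) (Fin (k + l)) ℍ[ℝ] :=
  Matrix.reindex finSumFinEquiv finSumFinEquiv (Matrix.fromBlocks A 0 0 B)

end QuaternionicKulkarni

end

/-! Up to scaling by powers of the eigenvalues, the `n`-th power acts on each block by binomial
coefficients `n choose r`, for every integer `n`. If `j` is the last index with a nonzero entry in a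
block, then dividing by `n choose j` sends the block to a multiple of its first basis vector. The
eigenvalue ratio decays exponentially and beats these polynomials, so a point with both blocks
nonzero tends to `e_{k+1}` as `n → +∞` and to `e_1` as `n → -∞`. A point with only one nonzero block
tends to the first basis point of that block at both ends (`eventually_attracted`,
`eventually_orbit`). These two points are fixed, and every orbit accumulates only there, which gives
`L₀` and `L₁`.

For `L₂ ⊆`, if the last entries of both blocks of `v` are nonzero, the attraction is uniform near
`v` at both ends (`eventually_flow_nhds`). A compact set avoiding the two fixed points also avoids
small cones around them, so its translates cannot accumulate at `v`.

For `L₂ ⊇`, if the last entry of a block vanishes, a perturbation of that entry tending to zero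
keeps the first entry of the dominant block equal in norm to the other block along the flow
(`exists_balanced`). The iterates then stay in a closed set `K` missing both fixed points, and
pulling `K` back along the flow returns arbitrarily close to the given point
(`ActsAsFlow.mem_kulkarniL2`). -/

noncomputable section

namespace QuaternionicKulkarni

open Filter

/-! ### Binomial coefficients with integral upper index -/

/-- The binomial coefficient `n.choose r` for an integer `n`, as a real number. -/
def zchoose : ℕ → ℤ → ℝ
  | 0, _ => 1
  | r + 1, n => zchoose r n * ((n - r) / (r + 1))

@[simp] lemma zchoose_zero_left (n : ℤ) : zchoose 0 n = 1 := rfl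

lemma zchoose_succ (r : ℕ) (n : ℤ) : zchoose (r + 1) n = zchoose r n * ((n - r) / (r + 1)) := rfl

lemma zchoose_succ_zero (r : ℕ) : zchoose (r + 1) 0 = 0 := by
  induction r with
  | zero => simp [zchoose_succ]
  | succ r ih => rw [zchoose_succ, ih, zero_mul]

/-- Pascal's rule at integral upper index is what lets a single formula describe the powers of a
Jordan block for negative exponents too. -/
lemma zchoose_pascal (r : ℕ) (n : ℤ) :
    zchoose (r + 1) (n + 1) = zchoose (r + 1) n + zchoose r n := by
  induction r with
  | zero => simp [zchoose_succ]
  | succ r ih =>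
    rw [zchoose_succ, ih, zchoose_succ (r + 1) n, zchoose_succ r n]
    push_cast
    field_simp
    ring

lemma zchoose_ne_zero {r : ℕ} {n : ℤ} (h : ∀ i < r, n ≠ i) : zchoose r n ≠ 0 := by
  induction r with
  | zero => simp
  | succ r ih =>
    rw [zchoose_succ]
    have h1 : (n : ℝ) - r ≠ 0 := by
      rw [sub_ne_zero]; exact_mod_cast h r (Nat.lt_succ_self r)
    have h2 : (r : ℝ) + 1 ≠ 0 := by positivity
    exact mul_ne_zero (ih fun i hi => h i (hi.trans (Nat.lt_succ_self r))) (div_ne_zero h1 h2)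

lemma eventually_zchoose_ne_zero (r : ℕ) : ∀ᶠ n in cofinite, zchoose r n ≠ 0 := by
  have h : {n : ℤ | ¬ zchoose r n ≠ 0} ⊆ (fun i : ℕ => (i : ℤ)) '' Set.Iio r := by
    intro n hn
    by_contra hc
    exact hn (zchoose_ne_zero fun i hi e => hc ⟨i, hi, e.symm⟩)
  exact ((Set.finite_Iio r).image _).subset h

lemma abs_zchoose_le (r : ℕ) (n : ℤ) : |zchoose r n| ≤ (|(n : ℝ)| + r) ^ r := by
  induction r with
  | zero => simp
  | succ r ih =>
    rw [zchoose_succ, abs_mul, pow_succ, abs_div]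
    have h1 : |(n : ℝ) - r| ≤ |(n : ℝ)| + (r + 1 : ℕ) := by
      have := abs_sub (n : ℝ) r
      rw [Nat.abs_cast] at this
      push_cast; linarith
    have h2 : (1 : ℝ) ≤ |(r : ℝ) + 1| := by
      rw [abs_of_nonneg (by positivity)]; linarith [(Nat.cast_nonneg r : (0 : ℝ) ≤ r)]
    have h3 : |(n : ℝ) - r| / |(r : ℝ) + 1| ≤ |(n : ℝ)| + (r + 1 : ℕ) :=
      (div_le_self (abs_nonneg _) h2).trans h1
    have h4 : (|(n : ℝ)| + r) ^ r ≤ (|(n : ℝ)| + (r + 1 : ℕ)) ^ r := by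
      gcongr; simp
    exact mul_le_mul (ih.trans h4) h3 (by positivity) (by positivity)

lemma tendsto_abs_intCast_cofinite : Tendsto (fun n : ℤ => |(n : ℝ)|) cofinite atTop := by
  rw [Int.cofinite_eq, tendsto_sup]
  exact ⟨tendsto_abs_atBot_atTop.comp (tendsto_intCast_atBot_iff.2 tendsto_id),
    tendsto_abs_atTop_atTop.comp (tendsto_intCast_atTop_iff.2 tendsto_id)⟩

/-- The quotient equals `(r + 1) / (n - r)` wherever `zchoose r n` is nonzero. -/
lemma tendsto_zchoose_div_succ (r : ℕ) :
    Tendsto (fun n => zchoose r n / zchoose (r + 1) n) cofinite (𝓝 0) := by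
  have h : Tendsto (fun n : ℤ => ((r : ℝ) + 1) * ((n : ℝ) - r)⁻¹) cofinite (𝓝 (((r : ℝ) + 1) * 0)) := by
    refine Tendsto.const_mul _ ?_
    rw [tendsto_zero_iff_norm_tendsto_zero]
    simp only [norm_inv]
    refine tendsto_inv_atTop_zero.comp ?_
    refine tendsto_atTop_mono (f := fun n : ℤ => |(n : ℝ)| - r) (fun n => ?_)
      (tendsto_atTop_add_const_right _ _ tendsto_abs_intCast_cofinite)
    have := abs_sub_abs_le_abs_sub (n : ℝ) r
    rwa [Nat.abs_cast] at this
  rw [mul_zero] at h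
  refine h.congr' ?_
  filter_upwards [eventually_zchoose_ne_zero r] with n hn
  rw [zchoose_succ, div_mul_cancel_left₀ hn, inv_div, div_eq_mul_inv]

lemma tendsto_zchoose_div {r s : ℕ} (h : r < s) :
    Tendsto (fun n => zchoose r n / zchoose s n) cofinite (𝓝 0) := by
  induction s, h using Nat.le_induction with
  | base => exact tendsto_zchoose_div_succ r
  | succ s hs ih =>
    have := ih.mul (tendsto_zchoose_div_succ s)
    rw [mul_zero] at this
    refine this.congr' ?_
    filter_upwards [eventually_zchoose_ne_zero s] with n hn
    rw [div_mul_div_cancel₀ hn]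

lemma tendsto_zchoose_inv_bdd (r : ℕ) :
    ∃ c, Tendsto (fun n => (zchoose r n)⁻¹) cofinite (𝓝 c) := by
  rcases r.eq_zero_or_pos with rfl | hr
  · exact ⟨1, by simp⟩
  · exact ⟨0, by simpa using tendsto_zchoose_div hr⟩

/-- Exponential decay beats a polynomial of degree `r`. The map `f` allows both `n` and `-n` as
upper index, one for each end of `ℤ`. -/
lemma tendsto_pow_mul_zchoose {ρ : ℝ} (h0 : 0 ≤ ρ) (h1 : ρ < 1) (r : ℕ) (f : ℕ → ℤ)
    (hf : ∀ n, |(f n : ℝ)| = n) :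
    Tendsto (fun n : ℕ => ρ ^ n * |zchoose r (f n)|) atTop (𝓝 0) := by
  have h := (tendsto_pow_const_mul_const_pow_of_lt_one r h0 h1).const_mul (((1 : ℝ) + r) ^ r)
  rw [mul_zero] at h
  refine squeeze_zero' (Eventually.of_forall fun n => by positivity) ?_ h
  filter_upwards [eventually_ge_atTop 1] with n hn
  have hn' : (1 : ℝ) ≤ n := by exact_mod_cast hn
  rw [← mul_assoc, ← mul_pow, mul_comm]
  refine mul_le_mul_of_nonneg_right ((abs_zchoose_le r _).trans ?_) (by positivity)
  rw [hf]
  gcongr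
  nlinarith [(Nat.cast_nonneg r : (0 : ℝ) ≤ r)]

lemma tendsto_zpow_ratio_atTop {x y : ℍ[ℝ]} (h : ‖x‖ < ‖y‖) (r : ℕ) :
    Tendsto (fun n : ℤ => ‖x ^ n‖ / ‖y ^ n‖ * |zchoose r n|) atTop (𝓝 0) := by
  rw [← Nat.map_cast_int_atTop, tendsto_map'_iff]
  have hy : 0 < ‖y‖ := (norm_nonneg x).trans_lt h
  refine (tendsto_pow_mul_zchoose (ρ := ‖x‖ / ‖y‖) (by positivity) ((div_lt_one hy).2 h) r
    (fun n => n) (by simp)).congr fun n => ?_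
  simp [div_pow]

lemma tendsto_zpow_ratio_atBot {x y : ℍ[ℝ]} (hx : x ≠ 0) (h : ‖x‖ < ‖y‖) (r : ℕ) :
    Tendsto (fun n : ℤ => ‖y ^ n‖ / ‖x ^ n‖ * |zchoose r n|) atBot (𝓝 0) := by
  rw [← map_neg_atTop, tendsto_map'_iff, ← Nat.map_cast_int_atTop, tendsto_map'_iff]
  have hx' : 0 < ‖x‖ := norm_pos_iff.2 hx
  have hy : 0 < ‖y‖ := (norm_nonneg x).trans_lt h
  refine (tendsto_pow_mul_zchoose (ρ := ‖x‖ / ‖y‖) (by positivity) ((div_lt_one hy).2 h) r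
    (fun n => -n) (by simp)).congr fun n => ?_
  simp only [Function.comp, zpow_neg, zpow_natCast, norm_inv, norm_pow, div_pow]
  field_simp

/-! ### Powers of a unipotent Jordan block -/

/-- The action of `J(1, m) ^ n` on column vectors. -/
def jpow {m : ℕ} (n : ℤ) (a : Fin m → ℍ[ℝ]) : Fin m → ℍ[ℝ] :=
  fun i => ∑ j, (if i ≤ j then zchoose (j - i) n else 0) • a j

lemma jpow_zero {m : ℕ} (a : Fin m → ℍ[ℝ]) : jpow 0 a = a := by
  ext1 i
  rw [jpow, Finset.sum_eq_single i]
  · simp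
  · intro j _ hj
    split_ifs with h
    · obtain ⟨r, hr⟩ : ∃ r, (j : ℕ) - i = r + 1 := by
        refine Nat.exists_eq_succ_of_ne_zero ?_
        have : (j : ℕ) ≠ i := fun h => hj (Fin.ext h)
        have : (i : ℕ) ≤ j := h
        omega
      rw [hr, zchoose_succ_zero, zero_smul]
    · simp
  · simp

lemma jpow_add_one {m : ℕ} (n : ℤ) (a : Fin m → ℍ[ℝ]) (i : Fin m) :
    jpow (n + 1) a i = jpow n a i + if h : (i : ℕ) + 1 < m then jpow n a ⟨i + 1, h⟩ else 0 := by
  have key : ∀ j : Fin m, (if i ≤ j then zchoose (j - i) (n + 1) else 0) =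
      (if i ≤ j then zchoose (j - i) n else 0) +
        if (i : ℕ) + 1 ≤ j then zchoose (j - (i + 1)) n else 0 := by
    intro j
    rcases lt_trichotomy (i : ℕ) j with h | h | h
    · obtain ⟨r, hr⟩ := Nat.exists_eq_add_of_lt h
      have h1 : (j : ℕ) - i = r + 1 := by omega
      have h2 : (j : ℕ) - (i + 1) = r := by omega
      rw [if_pos (Fin.le_def.2 h.le), if_pos (Fin.le_def.2 h.le), if_pos (Nat.succ_le_of_lt h), h1, h2, zchoose_pascal]
    · obtain rfl : i = j := Fin.ext h
      simp
    · have h1 : ¬ i ≤ j := not_le.2 h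
      rw [if_neg h1, if_neg h1, if_neg (by omega), add_zero]
  simp only [jpow, key, add_smul, Finset.sum_add_distrib]
  congr 1
  split_ifs with h
  · rfl
  · refine Finset.sum_eq_zero fun j _ => ?_
    rw [if_neg (by have := j.2; omega), zero_smul]

lemma J_smul_mulVec {m : ℕ} (c : ℍ[ℝ]) (a : Fin m → ℍ[ℝ]) (i : Fin m) :
    (c • J 1 m).mulVec a i = c * (a i + if h : (i : ℕ) + 1 < m then a ⟨i + 1, h⟩ else 0) := by
  have key : ∀ j : Fin m, (c • J 1 m) i j * a j =
      c * ((if i = j then a j else 0) + if (i : ℕ) + 1 = j then a j else 0) := by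
    intro j
    simp only [J, Matrix.smul_apply, Matrix.of_apply, smul_eq_mul]
    by_cases h : i = j
    · have : ¬ (i : ℕ) + 1 = j := by rw [h]; omega
      simp [h]
    · by_cases h' : (i : ℕ) + 1 = j <;> simp [h, h']
  simp only [Matrix.mulVec, dotProduct, key, ← Finset.mul_sum, Finset.sum_add_distrib]
  congr 2
  · simp
  · split_ifs with h
    · rw [Finset.sum_eq_single ⟨i + 1, h⟩] <;> simp +contextual [Fin.ext_iff, eq_comm]
    · refine Finset.sum_eq_zero fun j _ => if_neg (by have := j.2; omega)

/-- The coefficients of `jpow` are real, hence central, so the quaternion `c` separates from the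
unipotent part despite noncommutativity. -/
lemma J_smul_mulVec_zpow_jpow {m : ℕ} {c : ℍ[ℝ]} (hc : c ≠ 0) (n : ℤ) (a : Fin m → ℍ[ℝ]) :
    (c • J 1 m).mulVec (c ^ n • jpow n a) = c ^ (n + 1) • jpow (n + 1) a := by
  ext1 i
  rw [J_smul_mulVec, Pi.smul_apply, Pi.smul_apply, jpow_add_one, zpow_add_one₀ hc,
    (Commute.refl c).zpow_left₀ n |>.eq]
  split_ifs with h <;> simp [mul_add, mul_assoc]

/-! ### Asymptotics of the powers -/

section Asymptotics

variable {p q : ℕ} {ℓ : Filter ℤ} {E : Type*} {F : Filter E}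

/-- Among the terms `(n choose (r - i)) / (n choose j)` with `r ≤ j`, only `r = j`, `i = 0`
survives. The filter `F` covers two uses: a principal filter, for one orbit with any last nonzero
index `j`, and a full neighbourhood filter, where `j` is the last index and the vanishing condition
is empty. -/
lemma tendsto_inv_zchoose_smul_jpow {b : E → Fin q → ℍ[ℝ]} {b₀ : Fin q → ℍ[ℝ]}
    (hb : Tendsto b F (𝓝 b₀)) (j : Fin q) (hF : ∀ᶠ x in F, ∀ r > j, b x r = 0) (i : Fin q) :
    Tendsto (fun z : ℤ × E => (zchoose j z.1)⁻¹ • jpow z.1 (b z.2) i) (cofinite ×ˢ F)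
      (𝓝 (if (i : ℕ) = 0 then b₀ j else 0)) := by
  have hterm : ∀ r : Fin q, Tendsto (fun z : ℤ × E => (zchoose j z.1)⁻¹ •
      ((if i ≤ r then zchoose (r - i) z.1 else 0) • b z.2 r)) (cofinite ×ˢ F)
      (𝓝 (if r = j then (if (i : ℕ) = 0 then b₀ j else 0) else 0)) := by
    intro r
    have hbr : Tendsto (fun z : ℤ × E => b z.2 r) (cofinite ×ˢ F) (𝓝 (b₀ r)) :=
      (((continuous_apply r).tendsto _).comp hb).comp tendsto_snd
    by_cases hir : i ≤ r
    swap
    · have : (if r = j then (if (i : ℕ) = 0 then b₀ j else 0) else 0) = 0 := by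
        split_ifs with h1 h2
        · exact absurd (Fin.le_def.2 (by omega)) hir
        · rfl
        · rfl
      simpa [hir, this] using tendsto_const_nhds
    simp only [hir, if_true, smul_smul, inv_mul_eq_div]
    by_cases hrj : r > j
    · rw [if_neg hrj.ne']
      refine tendsto_const_nhds.congr' ?_
      filter_upwards [tendsto_snd.eventually hF] with z hz
      rw [hz r hrj, smul_zero]
    by_cases hlt : (r : ℕ) - i < j
    · have h := ((tendsto_zchoose_div hlt).comp
        (tendsto_fst (f := cofinite) (g := F))).smul hbr
      rw [zero_smul] at h
      have : (if r = j then (if (i : ℕ) = 0 then b₀ j else 0) else 0) = 0 := by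
        split_ifs with h1 h2
        · subst h1; omega
        · rfl
        · rfl
      rw [this]
      exact h
    · have h1 : (r : ℕ) ≤ j := Fin.le_def.1 (not_lt.1 hrj)
      have h2 : (i : ℕ) ≤ r := hir
      have hi : (i : ℕ) = 0 ∨ (r : ℕ) = 0 := by omega
      have hi0 : (i : ℕ) = 0 := by omega
      obtain rfl : r = j := Fin.ext (by omega)
      rw [if_pos rfl, if_pos hi0, hi0, Nat.sub_zero]
      refine hbr.congr' ?_
      filter_upwards [tendsto_fst.eventually (eventually_zchoose_ne_zero (r : ℕ))] with z hz
      rw [div_self hz, one_smul]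
  have h := tendsto_finsetSum Finset.univ fun r _ => hterm r
  rw [Finset.sum_ite_eq' Finset.univ j] at h
  simpa only [jpow, Finset.smul_sum, Finset.mem_univ, if_true] using h

lemma tendsto_ratio_mul_norm_jpow {ρ : ℤ → ℝ}
    (hρ : ∀ r, Tendsto (fun n => ρ n * |zchoose r n|) ℓ (𝓝 0))
    {a : E → Fin p → ℍ[ℝ]} {a₀ : Fin p → ℍ[ℝ]} (ha : Tendsto a F (𝓝 a₀)) (i : Fin p) :
    Tendsto (fun z : ℤ × E => ρ z.1 * ‖jpow z.1 (a z.2) i‖) (ℓ ×ˢ F) (𝓝 0) := by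
  have hterm : ∀ r : Fin p, Tendsto (fun z : ℤ × E => |ρ z.1| * ‖(if i ≤ r then
      zchoose (r - i) z.1 else 0) • a z.2 r‖) (ℓ ×ˢ F) (𝓝 0) := by
    intro r
    by_cases hir : i ≤ r
    swap
    · simpa [hir] using tendsto_const_nhds
    have har : Tendsto (fun z : ℤ × E => ‖a z.2 r‖) (ℓ ×ˢ F) (𝓝 ‖a₀ r‖) :=
      ((((continuous_apply r).tendsto _).comp ha).comp tendsto_snd).norm
    have h := ((hρ (r - i)).abs.comp (tendsto_fst (f := ℓ) (g := F))).mul har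
    rw [abs_zero, zero_mul] at h
    refine h.congr fun z => ?_
    simp [hir, norm_smul, abs_mul, mul_assoc]
  have h := tendsto_finsetSum Finset.univ fun r _ => hterm r
  rw [Finset.sum_const_zero] at h
  refine squeeze_zero_norm (fun z => ?_) h
  rw [norm_mul, norm_norm, Real.norm_eq_abs, ← Finset.mul_sum]
  exact mul_le_mul_of_nonneg_left (norm_sum_le _ _) (abs_nonneg _)

/-- When `t` dominates `s`, the pair `(s n • J ^ n a, t n • J ^ n b)` is attracted by the first
basis vector of the second block. -/
lemma eventually_attracted [NeZero q] (hℓ : ℓ ≤ cofinite) {s t : ℤ → ℍ[ℝ]} (ht : ∀ n, t n ≠ 0)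
    (hst : ∀ r, Tendsto (fun n => ‖s n‖ / ‖t n‖ * |zchoose r n|) ℓ (𝓝 0))
    {a : E → Fin p → ℍ[ℝ]} {a₀ : Fin p → ℍ[ℝ]} (ha : Tendsto a F (𝓝 a₀))
    {b : E → Fin q → ℍ[ℝ]} {b₀ : Fin q → ℍ[ℝ]} (hb : Tendsto b F (𝓝 b₀))
    (j : Fin q) (hj : b₀ j ≠ 0) (hF : ∀ᶠ x in F, ∀ r > j, b x r = 0) {ε : ℝ} (hε : 0 < ε) :
    ∀ᶠ z in ℓ ×ˢ F,
      (∀ i, ‖(s z.1 • jpow z.1 (a z.2)) i‖ ≤ ε * ‖(t z.1 • jpow z.1 (b z.2)) 0‖) ∧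
      ∀ i ≠ 0, ‖(t z.1 • jpow z.1 (b z.2)) i‖ ≤ ε * ‖(t z.1 • jpow z.1 (b z.2)) 0‖ := by
  -- After division by `‖t n‖` and by `|n choose j|`, the first entry of the second block tends to
  -- `‖b₀ j‖ > 0` and all other entries of either block tend to `0`.
  have hB : ∀ i, Tendsto (fun z : ℤ × E => |zchoose j z.1|⁻¹ * ‖jpow z.1 (b z.2) i‖) (ℓ ×ˢ F)
      (𝓝 ‖if (i : ℕ) = 0 then b₀ j else 0‖) := fun i => by
    refine ((tendsto_inv_zchoose_smul_jpow hb j hF i).mono_left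
      (prod_mono hℓ le_rfl)).norm.congr fun z => ?_
    rw [norm_smul, norm_inv, Real.norm_eq_abs]
  have hA : ∀ i, Tendsto (fun z : ℤ × E => |zchoose j z.1|⁻¹ *
      (‖s z.1‖ / ‖t z.1‖ * ‖jpow z.1 (a z.2) i‖)) (ℓ ×ˢ F) (𝓝 0) := fun i => by
    obtain ⟨c, hc⟩ := tendsto_zchoose_inv_bdd j
    have h := ((hc.mono_left hℓ).abs.comp (tendsto_fst (f := ℓ) (g := F))).mul
      (tendsto_ratio_mul_norm_jpow hst ha i)
    rw [mul_zero] at h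
    refine h.congr fun z => ?_
    simp [abs_inv]
  have h0 : Tendsto (fun z : ℤ × E => ε * (|zchoose j z.1|⁻¹ * ‖jpow z.1 (b z.2) 0‖)) (ℓ ×ˢ F)
      (𝓝 (ε * ‖b₀ j‖)) := by simpa using (hB 0).const_mul ε
  have hpos : 0 < ε * ‖b₀ j‖ := mul_pos hε (norm_pos_iff.2 hj)
  have hC := (tendsto_fst (g := F)).eventually (hℓ (eventually_zchoose_ne_zero (j : ℕ)))
  rw [eventually_and, eventually_all, eventually_all]
  refine ⟨fun i => ?_, fun i => ?_⟩
  · filter_upwards [(hA i).eventually_lt h0 hpos, hC] with z hz hz'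
    have hc : 0 < |zchoose j z.1|⁻¹ := by positivity
    have ht' := norm_pos_iff.2 (ht z.1)
    rw [mul_left_comm ε, mul_lt_mul_iff_right₀ hc, div_mul_eq_mul_div, div_lt_iff₀ ht'] at hz
    simp only [Pi.smul_apply, smul_eq_mul, norm_mul]
    linarith
  · by_cases hi : i = 0
    · exact Eventually.of_forall fun z h => absurd hi h
    have h1 := hB i
    rw [if_neg (mt Fin.val_eq_zero_iff.1 hi), norm_zero] at h1
    filter_upwards [h1.eventually_lt h0 hpos, hC] with z hz hz' _
    have hc : 0 < |zchoose j z.1|⁻¹ := by positivity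
    rw [mul_left_comm ε, mul_lt_mul_iff_right₀ hc] at hz
    simp only [Pi.smul_apply, smul_eq_mul, norm_mul]
    rw [mul_left_comm]
    exact mul_le_mul_of_nonneg_left hz.le (norm_nonneg _)

/-- A vector `a` with vanishing last entry can be perturbed to balance the first entry of its
iterate with the iterate of `b` in a dominated block. -/
lemma exists_balanced [NeZero p] (hℓ : ℓ ≤ cofinite) {s t : ℤ → ℍ[ℝ]} (hs : ∀ n, s n ≠ 0)
    (hst : ∀ r, Tendsto (fun n => ‖t n‖ / ‖s n‖ * |zchoose r n|) ℓ (𝓝 0))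
    (a : Fin p → ℍ[ℝ]) (b : Fin q → ℍ[ℝ]) (j : Fin p) (hj : (j : ℕ) + 1 = p) (ha : a j = 0) :
    ∃ c : ℤ → Fin p → ℍ[ℝ], Tendsto c ℓ (𝓝 a) ∧
      ∀ᶠ n in ℓ, ‖(s n • jpow n (c n)) 0‖ = ‖t n • jpow n b‖ := by
  -- `τ n` is the norm that the first entry of `jpow n (c n)` must have.
  set τ : ℤ → ℝ := fun n => ‖t n‖ / ‖s n‖ * ‖jpow n b‖ with hτdef
  have hτ : Tendsto τ ℓ (𝓝 0) := by
    have h := tendsto_finsetSum Finset.univ fun i _ =>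
      (tendsto_ratio_mul_norm_jpow (F := pure ()) hst (tendsto_const_nhds (x := b)) i).comp
        (tendsto_id.prodMk (tendsto_const_pure (b := ())))
    rw [Finset.sum_const_zero] at h
    refine squeeze_zero (fun n => by positivity) (fun n => ?_) h
    simp only [Function.comp, id, ← Finset.mul_sum, hτdef]
    refine mul_le_mul_of_nonneg_left ?_ (by positivity)
    refine (pi_norm_le_iff_of_nonneg (by positivity)).2 fun i => ?_
    exact Finset.single_le_sum (f := fun i => ‖jpow n b i‖) (fun _ _ => norm_nonneg _)
      (Finset.mem_univ i)
  -- The last entry enters the first entry of the iterate with coefficient `n choose j`, so `u n`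
  -- solves `jpow n (a + Pi.single j (u n)) 0 = τ n`. It tends to `0` because `τ` does and because
  -- `jpow n a 0 / (n choose j)` tends to `a j = 0`.
  set u : ℤ → ℍ[ℝ] := fun n => (zchoose j n)⁻¹ • ((τ n : ℍ[ℝ]) - jpow n a 0) with hudef
  have hu : Tendsto u ℓ (𝓝 0) := by
    obtain ⟨d, hd⟩ := tendsto_zchoose_inv_bdd j
    have hτ' : Tendsto (fun n => (τ n : ℍ[ℝ])) ℓ (𝓝 ((0 : ℝ) : ℍ[ℝ])) :=
      (Quaternion.continuous_coe.tendsto 0).comp hτ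
    have h1 := (hd.mono_left hℓ).smul hτ'
    have h2 := ((tendsto_inv_zchoose_smul_jpow (F := pure ()) (tendsto_const_nhds (x := a)) j
      (Eventually.of_forall fun _ r hr => absurd (Fin.lt_def.1 hr) (by have := r.2; omega)) 0).comp
        (tendsto_id.prodMk (tendsto_const_pure (b := ())))).mono_left hℓ
    have h3 := h1.sub h2
    simp only [Quaternion.coe_zero, smul_zero, ha, ite_self, sub_zero] at h3
    refine h3.congr fun n => ?_
    simp [hudef, smul_sub]
  refine ⟨fun n => a + Pi.single j (u n), ?_, ?_⟩
  · have h := (tendsto_const_nhds (x := a)).add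
      (((continuous_single (A := fun _ : Fin p => ℍ[ℝ]) j).tendsto 0).comp hu)
    simpa using h
  · filter_upwards [hℓ (eventually_zchoose_ne_zero (j : ℕ))] with n hn
    have h0 : jpow n (a + Pi.single j (u n)) 0 = τ n := by
      have h1 : jpow n (a + Pi.single j (u n)) 0 = jpow n a 0 + zchoose j n • u n := by
        simp only [jpow, Pi.add_apply, smul_add, Finset.sum_add_distrib]
        congr 1
        rw [Finset.sum_eq_single j] <;> simp +contextual
      rw [h1, hudef]
      simp only [smul_smul, mul_inv_cancel₀ hn, one_smul]
      abel
    have hs' := norm_pos_iff.2 (hs n)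
    rw [Pi.smul_apply, h0, smul_eq_mul, norm_mul, Quaternion.norm_coe, norm_smul, hτdef,
      Real.norm_of_nonneg (by positivity)]
    field_simp

end Asymptotics

/-! ### Topology of the quaternionic projective space -/

section Topology

variable {n : ℕ}

/-- The set of points of projective space whose representatives lie in `Q`. -/
def projSet (Q : Set (Fin n → ℍ[ℝ])) : Set (HP n) := {x | x.rep ∈ Q}

/-- A set of vectors which is stable under scaling. -/
def IsHomogeneous (Q : Set (Fin n → ℍ[ℝ])) : Prop :=
  ∀ α : ℍ[ℝ]ᵐᵒᵖ, α ≠ 0 → ∀ v ∈ Q, α • v ∈ Q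

lemma IsHomogeneous.mk_mem_projSet {Q : Set (Fin n → ℍ[ℝ])} (hQ : IsHomogeneous Q)
    {v : Fin n → ℍ[ℝ]} (hv : v ≠ 0) :
    Projectivization.mk ℍ[ℝ]ᵐᵒᵖ v hv ∈ projSet Q ↔ v ∈ Q := by
  obtain ⟨a, ha⟩ := Projectivization.exists_smul_eq_mk_rep ℍ[ℝ]ᵐᵒᵖ v hv
  change (Projectivization.mk ℍ[ℝ]ᵐᵒᵖ v hv).rep ∈ Q ↔ _
  rw [← ha]
  refine ⟨fun h => ?_, fun h => hQ a a.ne_zero v h⟩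
  have := hQ (a⁻¹ : ℍ[ℝ]ᵐᵒᵖˣ) (a⁻¹).ne_zero _ h
  rwa [← Units.smul_def, inv_smul_smul] at this

lemma continuous_mk : Continuous fun v : {v : Fin n → ℍ[ℝ] // v ≠ 0} =>
    Projectivization.mk ℍ[ℝ]ᵐᵒᵖ v.1 v.2 :=
  continuous_quotient_mk'

lemma isOpen_iff_preimage_mk {S : Set (HP n)} : IsOpen S ↔
    IsOpen ((fun v : {v : Fin n → ℍ[ℝ] // v ≠ 0} => Projectivization.mk ℍ[ℝ]ᵐᵒᵖ v.1 v.2) ⁻¹' S) :=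
  isQuotientMap_quotient_mk'.isOpen_preimage.symm

lemma IsHomogeneous.isClosed_projSet {Q : Set (Fin n → ℍ[ℝ])} (hQ : IsHomogeneous Q)
    (hc : IsClosed Q) : IsClosed (projSet Q) := by
  rw [← isOpen_compl_iff, isOpen_iff_preimage_mk]
  convert (hc.preimage continuous_subtype_val).isOpen_compl using 1
  ext v
  exact not_congr (hQ.mk_mem_projSet v.2)

/-- The saturation of an open set is the union of its preimages under the scalings, which are
continuous. -/
lemma isOpenMap_mk : IsOpenMap fun v : {v : Fin n → ℍ[ℝ] // v ≠ 0} =>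
    Projectivization.mk ℍ[ℝ]ᵐᵒᵖ v.1 v.2 := by
  intro S hS
  rw [isOpen_iff_preimage_mk]
  have hsmul : ∀ a : ℍ[ℝ]ᵐᵒᵖˣ, Continuous fun v : {v : Fin n → ℍ[ℝ] // v ≠ 0} =>
      (⟨a • v.1, (smul_ne_zero_iff_ne a).2 v.2⟩ : {v : Fin n → ℍ[ℝ] // v ≠ 0}) := fun a => by
    refine Continuous.subtype_mk (continuous_pi fun i => ?_) _
    exact ((continuous_apply i).comp continuous_subtype_val).mul continuous_const
  convert isOpen_iUnion fun a => hS.preimage (hsmul a) using 1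
  ext v
  simp only [Set.mem_preimage, Set.mem_image, Set.mem_iUnion]
  constructor
  · rintro ⟨w, hw, h⟩
    obtain ⟨a, ha⟩ := (Projectivization.mk_eq_mk_iff _ _ _ _ _).1 h
    exact ⟨a, by simpa only [ha] using hw⟩
  · rintro ⟨a, ha⟩
    exact ⟨_, ha, (Projectivization.mk_eq_mk_iff _ _ _ _ _).2 ⟨a, rfl⟩⟩

instance : CompactSpace (HP n) := by
  have : ProperSpace ℍ[ℝ] := FiniteDimensional.proper ℝ _
  have hK : IsCompact (Metric.sphere (0 : Fin n → ℍ[ℝ]) 1) := isCompact_sphere _ _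
  have hne : ∀ v : Metric.sphere (0 : Fin n → ℍ[ℝ]) 1, v.1 ≠ 0 := fun v =>
    ne_zero_of_mem_unit_sphere v
  have hcont : Continuous fun v : Metric.sphere (0 : Fin n → ℍ[ℝ]) 1 =>
      Projectivization.mk ℍ[ℝ]ᵐᵒᵖ v.1 (hne v) :=
    continuous_mk.comp (continuous_subtype_val.subtype_mk hne)
  have := isCompact_iff_compactSpace.1 hK
  refine ⟨?_⟩
  convert isCompact_range hcont
  symm
  rw [Set.eq_univ_iff_forall]
  intro x
  induction x using Projectivization.ind with
  | h v hv =>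
    have hv' : ‖v‖ ≠ 0 := norm_ne_zero_iff.2 hv
    -- Real quaternions are central, so normalising by a real factor is a right scaling and the unit
    -- sphere meets every class.
    have hα : MulOpposite.op ((‖v‖⁻¹ : ℝ) : ℍ[ℝ]) • v = ‖v‖⁻¹ • v := by
      ext1 i
      simp only [Pi.smul_apply, MulOpposite.smul_eq_mul_unop, MulOpposite.unop_op]
      rw [Quaternion.mul_coe_eq_smul]
    refine ⟨⟨‖v‖⁻¹ • v, ?_⟩, ?_⟩
    · rw [mem_sphere_zero_iff_norm, norm_smul, norm_inv, norm_norm, inv_mul_cancel₀ hv']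
    · exact (Projectivization.mk_eq_mk_iff' _ _ _ _ _).2 ⟨_, hα⟩

lemma isHomogeneous_coord_eq_zero (m : Fin n) : IsHomogeneous {v : Fin n → ℍ[ℝ] | v m = 0} := by
  intro α _ v hv
  simpa using Or.inl hv

lemma isClosed_coord_eq_zero (m : Fin n) :
    IsClosed (projSet {v : Fin n → ℍ[ℝ] | v m = 0}) :=
  (isHomogeneous_coord_eq_zero m).isClosed_projSet
    (isClosed_eq (continuous_apply m) continuous_const)

lemma L_eq_projSet (m : Fin n) :
    L {x | ∃ i : Fin n, i ≠ m ∧ x = e i} = projSet {v : Fin n → ℍ[ℝ] | v m = 0} := by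
  set S : Set (HP n) := {x | ∃ i : Fin n, i ≠ m ∧ x = e i}
  -- The coordinate hyperplane is the projective subspace of the kernel of a right-linear
  -- projection, so the minimality of the span applies to it.
  have hker : ∀ x : HP n, x ∈ Projectivization.Subspace.submodule.symm
      (LinearMap.ker (LinearMap.proj m : (Fin n → ℍ[ℝ]) →ₗ[ℍ[ℝ]ᵐᵒᵖ] ℍ[ℝ])) ↔
      x ∈ projSet {v : Fin n → ℍ[ℝ] | v m = 0} := by
    intro x
    induction x using Projectivization.ind with
    | h v hv =>
      rw [(isHomogeneous_coord_eq_zero m).mk_mem_projSet, ← Projectivization.Subspace.mem_submodule_iff _ hv]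
      simp
  ext x
  change x ∈ Projectivization.Subspace.span S ↔ _
  constructor
  · intro h
    rw [← hker]
    refine (Projectivization.Subspace.mem_span x).1 h _ ?_
    rintro _ ⟨i, hi, rfl⟩
    refine (hker _).2 (((isHomogeneous_coord_eq_zero m).mk_mem_projSet _).2 ?_)
    simp [hi.symm]
  · induction x using Projectivization.ind with
    | h v hv =>
      rw [(isHomogeneous_coord_eq_zero m).mk_mem_projSet, ← Projectivization.Subspace.mem_submodule_iff _ hv]
      intro h
      rw [← Finset.univ_sum_single v]
      refine Submodule.sum_mem _ fun i _ => ?_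
      by_cases hi : i = m
      · have h0 : v i = 0 := hi ▸ h
        simp [h0]
      · have h1 : (Pi.single i (v i) : Fin n → ℍ[ℝ]) =
            MulOpposite.op (v i) • (Pi.single i 1 : Fin n → ℍ[ℝ]) := by
          rw [← Pi.single_smul]; simp
        rw [h1]
        refine Submodule.smul_mem _ _ ?_
        rw [Projectivization.Subspace.mem_submodule_iff _ (by simp)]
        exact Projectivization.Subspace.subset_span S ⟨i, hi, rfl⟩

/-- The vectors whose entries other than the `i`-th have relative size at most `ε`. -/
def cone (i : Fin n) (ε : ℝ) : Set (Fin n → ℍ[ℝ]) := {v | ∀ j ≠ i, ‖v j‖ ≤ ε * ‖v i‖}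

lemma isHomogeneous_cone (i : Fin n) (ε : ℝ) : IsHomogeneous (cone i ε) := by
  intro α _ v hv j hj
  simp only [Pi.smul_apply, MulOpposite.smul_eq_mul_unop, norm_mul]
  rw [← mul_assoc]
  exact mul_le_mul_of_nonneg_right (hv j hj) (norm_nonneg _)

lemma isClosed_projSet_cone (i : Fin n) (ε : ℝ) : IsClosed (projSet (cone i ε)) := by
  refine (isHomogeneous_cone i ε).isClosed_projSet ?_
  simp only [cone, Set.ofPred_forall]
  refine isClosed_iInter fun j => isClosed_iInter fun _ => isClosed_le ?_ ?_ <;> fun_prop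

lemma cone_mono (i : Fin n) {ε δ : ℝ} (h : ε ≤ δ) : cone i ε ⊆ cone i δ :=
  fun _ hv j hj => (hv j hj).trans (mul_le_mul_of_nonneg_right h (norm_nonneg _))

lemma coord_ne_zero_of_mem_cone {i : Fin n} {ε : ℝ} {v : Fin n → ℍ[ℝ]} (hv : v ≠ 0)
    (h : v ∈ cone i ε) : v i ≠ 0 := by
  intro h0
  refine hv (funext fun j => ?_)
  by_cases hj : j = i
  · rw [hj, h0]; rfl
  · simpa [h0] using h j hj

lemma mk_eq_mk_div {v : Fin n → ℍ[ℝ]} (hv : v ≠ 0) {i : Fin n} (hi : v i ≠ 0) :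
    ∃ hw : (fun j => v j * (v i)⁻¹) ≠ 0,
      Projectivization.mk ℍ[ℝ]ᵐᵒᵖ v hv = Projectivization.mk ℍ[ℝ]ᵐᵒᵖ (fun j => v j * (v i)⁻¹) hw := by
  have hw : (fun j => v j * (v i)⁻¹) ≠ 0 := fun h => by
    have := congrFun h i
    simp [hi] at this
  refine ⟨hw, (Projectivization.mk_eq_mk_iff' _ _ _ _ _).2 ⟨MulOpposite.op (v i), ?_⟩⟩
  ext1 j
  simp [hi]

lemma exists_projSet_cone_subset (i : Fin n) {N : Set (HP n)} (hN : N ∈ 𝓝 (e i)) :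
    ∃ ε > 0, projSet (cone i ε) ⊆ N := by
  have hne : (Pi.single i 1 : Fin n → ℍ[ℝ]) ≠ 0 := by simp
  have h1 := continuous_mk.continuousAt (x := ⟨Pi.single i 1, hne⟩) hN
  rw [mem_map, Metric.mem_nhds_iff] at h1
  obtain ⟨δ, hδ, h1⟩ := h1
  -- The cone condition is a weak inequality while the ball of radius `δ` is open, hence the half.
  refine ⟨δ / 2, by positivity, fun x hx => ?_⟩
  induction x using Projectivization.ind with
  | h v hv =>
    rw [(isHomogeneous_cone i _).mk_mem_projSet] at hx
    have hi := coord_ne_zero_of_mem_cone hv hx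
    obtain ⟨hw, h⟩ := mk_eq_mk_div hv hi
    rw [h]
    refine h1 (a := ⟨_, hw⟩) ?_
    rw [Metric.mem_ball, Subtype.dist_eq]
    refine lt_of_le_of_lt ((dist_pi_le_iff (by positivity)).2 fun j => ?_) (half_lt_self hδ)
    by_cases hj : j = i
    · subst hj
      simp [hi]; positivity
    · dsimp only
      rw [Pi.single_eq_of_ne hj, dist_zero_right, norm_mul, norm_inv,
        ← div_eq_mul_inv, div_le_iff₀ (norm_pos_iff.2 hi)]
      exact hx j hj

/-- The closed cones shrink to the point `e i`. This separates it from other points without appeal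
to a Hausdorff property of the projective space. -/
lemma eq_e_of_forall_mem_cone {i : Fin n} {x : HP n}
    (h : ∀ ε > 0, x ∈ projSet (cone i ε)) : x = e i := by
  induction x using Projectivization.ind with
  | h v hv =>
    simp only [(isHomogeneous_cone i _).mk_mem_projSet] at h
    refine (Projectivization.mk_eq_mk_iff' _ _ _ _ _).2 ⟨MulOpposite.op (v i), ?_⟩
    ext1 j
    by_cases hj : j = i
    · subst hj; simp
    · have h0 : ‖v j‖ ≤ 0 := by
        refine le_of_forall_pos_le_add fun ε hε => ?_
        have hi : 0 < ‖v i‖ := norm_pos_iff.2 (coord_ne_zero_of_mem_cone hv (h 1 one_pos))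
        have := h (ε / ‖v i‖) (by positivity) j hj
        rwa [div_mul_cancel₀ _ hi.ne', ← zero_add ε] at this
      simp [hj, norm_le_zero_iff.1 h0]

lemma isClosed_singleton_e (i : Fin n) : IsClosed {(e i : HP n)} := by
  convert isClosed_projSet_cone i 0
  ext x
  constructor
  · rintro rfl
    refine ((isHomogeneous_cone i _).mk_mem_projSet _).2 fun j hj => ?_
    simp [hj]
  · intro h
    exact eq_e_of_forall_mem_cone fun ε hε => cone_mono i hε.le h

/-- The cones of aperture `1 / (m + 1)` are closed, nested and meet only in `e i`, so compactness
makes one of them miss `K`. -/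
lemma exists_disjoint_projSet_cone {K : Set (HP n)} (hK : IsCompact K) (i : Fin n)
    (hi : e i ∉ K) : ∃ ε > 0, Disjoint K (projSet (cone i ε)) := by
  have h : K ∩ ⋂ m : ℕ, projSet (cone i (1 / ((m : ℝ) + 1))) = ∅ := by
    rw [Set.eq_empty_iff_forall_notMem]
    rintro x ⟨hxK, hx⟩
    rw [Set.mem_iInter] at hx
    refine hi ((eq_e_of_forall_mem_cone fun ε hε => ?_ : x = e i) ▸ hxK)
    obtain ⟨m, hm⟩ := exists_nat_one_div_lt hε
    exact cone_mono i hm.le (hx m)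
  obtain ⟨m, hm⟩ := hK.elim_directed_family_closed _
    (fun m => isClosed_projSet_cone i _) h (directed_of_isDirected_le fun a b hab x hx => by
      refine cone_mono i ?_ hx
      gcongr)
  exact ⟨_, by positivity, Set.disjoint_iff_inter_eq_empty.2 hm⟩

end Topology

/-! ### Cyclic groups -/

/-- For an element of infinite order, infinitely many group elements amount to infinitely many
exponents, so the Kulkarni conditions become statements along `cofinite` on `ℤ`. -/
lemma infinite_zpowers_setOf_iff {G : Type*} [Group G] {g : G}
    (hg : Function.Injective fun n : ℤ => g ^ n) (P : Subgroup.zpowers g → Prop) :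
    {b | P b}.Infinite ↔ ∃ᶠ n : ℤ in cofinite, P ⟨g ^ n, n, rfl⟩ := by
  rw [frequently_cofinite_iff_infinite]
  have hinj : Function.Injective fun n : ℤ => (⟨g ^ n, n, rfl⟩ : Subgroup.zpowers g) :=
    fun a b h => hg (congrArg Subtype.val h)
  rw [← Set.infinite_image_iff (hinj.injOn (s := {n | P ⟨g ^ n, n, rfl⟩}))]
  convert Iff.rfl using 2
  ext b
  constructor
  · rintro ⟨n, hn, rfl⟩; exact hn
  · obtain ⟨_, n, rfl⟩ := b
    exact fun h => ⟨n, h, rfl⟩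

lemma tendsto_neg_cofinite : Tendsto (fun n : ℤ => -n) cofinite cofinite :=
  neg_injective.tendsto_cofinite

lemma atTop_le_cofinite_int : (atTop : Filter ℤ) ≤ cofinite := by
  rw [Int.cofinite_eq]; exact le_sup_right

lemma atBot_le_cofinite_int : (atBot : Filter ℤ) ≤ cofinite := by
  rw [Int.cofinite_eq]; exact le_sup_left

/-! ### The flow of a block diagonal matrix with two Jordan blocks -/

variable {k l : ℕ}

/-- The entries of a vector in the first block. -/
def fstBlock (v : Fin (k + l) → ℍ[ℝ]) : Fin k → ℍ[ℝ] := fun i => v (Fin.castAdd l i)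

/-- The entries of a vector in the second block. -/
def sndBlock (v : Fin (k + l) → ℍ[ℝ]) : Fin l → ℍ[ℝ] := fun i => v (Fin.natAdd k i)

lemma continuous_fstBlock : Continuous (fstBlock : (Fin (k + l) → ℍ[ℝ]) → _) :=
  continuous_pi fun _ => continuous_apply _

lemma continuous_sndBlock : Continuous (sndBlock : (Fin (k + l) → ℍ[ℝ]) → _) :=
  continuous_pi fun _ => continuous_apply _

/-- The action of the `n`-th power of the block diagonal matrix with blocks `x J(1, k)` and
`y J(1, l)` on column vectors. -/
def flow (x y : ℍ[ℝ]) (n : ℤ) (v : Fin (k + l) → ℍ[ℝ]) : Fin (k + l) → ℍ[ℝ] :=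
  Fin.append (x ^ n • jpow n (fstBlock v)) (y ^ n • jpow n (sndBlock v))

@[simp] lemma flow_castAdd (x y : ℍ[ℝ]) (n : ℤ) (v : Fin (k + l) → ℍ[ℝ]) (i : Fin k) :
    flow x y n v (Fin.castAdd l i) = (x ^ n • jpow n (fstBlock v)) i := by simp [flow]

@[simp] lemma flow_natAdd (x y : ℍ[ℝ]) (n : ℤ) (v : Fin (k + l) → ℍ[ℝ]) (i : Fin l) :
    flow x y n v (Fin.natAdd k i) = (y ^ n • jpow n (sndBlock v)) i := by simp [flow]

lemma flow_zero (x y : ℍ[ℝ]) (v : Fin (k + l) → ℍ[ℝ]) : flow x y 0 v = v := by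
  ext1 i
  refine Fin.addCases (fun i => ?_) (fun i => ?_) i <;> simp [jpow_zero, fstBlock, sndBlock]

lemma blockDiag_mulVec_append (A : Matrix (Fin k) (Fin k) ℍ[ℝ]) (B : Matrix (Fin l) (Fin l) ℍ[ℝ])
    (a : Fin k → ℍ[ℝ]) (b : Fin l → ℍ[ℝ]) :
    (blockDiag A B).mulVec (Fin.append a b) = Fin.append (A.mulVec a) (B.mulVec b) := by
  ext1 i
  refine Fin.addCases (fun i => ?_) (fun i => ?_) i <;>
    simp [blockDiag, Matrix.mulVec, dotProduct, Fin.sum_univ_add]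

lemma blockDiag_mulVec_flow {x y : ℍ[ℝ]} (hx : x ≠ 0) (hy : y ≠ 0) (n : ℤ)
    (v : Fin (k + l) → ℍ[ℝ]) :
    (blockDiag (x • J 1 k) (y • J 1 l)).mulVec (flow x y n v) = flow x y (n + 1) v := by
  rw [flow, blockDiag_mulVec_append, J_smul_mulVec_zpow_jpow hx, J_smul_mulVec_zpow_jpow hy, flow]

lemma SL.zpow_smul_eq_flow {x y : ℍ[ℝ]} (hx : x ≠ 0) (hy : y ≠ 0) {γ : SL (k + l)}
    (hγ : γ.mat = blockDiag (x • J 1 k) (y • J 1 l)) (n : ℤ) (v : Fin (k + l) → ℍ[ℝ]) :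
    γ ^ n • v = flow x y n v := by
  have hstep : ∀ n v, γ • flow x y n v = flow x y (n + 1) v := fun n v => by
    rw [SL.smul_def, hγ, blockDiag_mulVec_flow hx hy]
  induction n with
  | zero => rw [zpow_zero, one_smul, flow_zero]
  | succ n ih => rw [add_comm (n : ℤ) 1, zpow_add, zpow_one, mul_smul, ih, hstep, add_comm (n : ℤ) 1]
  | pred n ih =>
    -- Negative exponents are reached by cancelling one application of `γ`.
    apply MulAction.injective γ
    change γ • _ = γ • _
    rw [hstep, smul_smul, ← zpow_one_add, sub_add_cancel, add_sub_cancel, ih]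

/-- With `x = 0` the invertible matrix would kill the first basis vector. -/
lemma SL.fst_ne_zero [NeZero k] {x y : ℍ[ℝ]} {γ : SL (k + l)}
    (hγ : γ.mat = blockDiag (x • J 1 k) (y • J 1 l)) : x ≠ 0 := by
  rintro rfl
  have h : γ • (Fin.append (Pi.single 0 1) 0 : Fin (k + l) → ℍ[ℝ]) = 0 := by
    rw [SL.smul_def, hγ, blockDiag_mulVec_append]
    ext1 i
    refine Fin.addCases (fun i => ?_) (fun i => ?_) i <;> simp
  rw [smul_eq_zero_iff_eq] at h
  simpa using congrFun h (Fin.castAdd l 0)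

lemma exists_last_ne_zero {m : ℕ} {b : Fin m → ℍ[ℝ]} (hb : b ≠ 0) :
    ∃ j, b j ≠ 0 ∧ ∀ r > j, b r = 0 := by
  classical
  have hne : (Finset.univ.filter fun i => b i ≠ 0).Nonempty := by
    obtain ⟨i, hi⟩ := Function.ne_iff.1 hb
    exact ⟨i, by simpa using hi⟩
  refine ⟨_, (Finset.mem_filter.1 (Finset.max'_mem _ hne)).2, fun r hr => ?_⟩
  by_contra hr'
  exact absurd (Finset.le_max' _ r (by simpa using hr')) (not_le.2 hr)

lemma jpow_zero_right {m : ℕ} (n : ℤ) : jpow n (0 : Fin m → ℍ[ℝ]) = 0 := by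
  ext1 i
  simp [jpow]

lemma mem_cone_castAdd [NeZero k] {v : Fin (k + l) → ℍ[ℝ]} {ε : ℝ}
    (h₁ : ∀ i, ‖sndBlock v i‖ ≤ ε * ‖fstBlock v 0‖)
    (h₂ : ∀ i ≠ 0, ‖fstBlock v i‖ ≤ ε * ‖fstBlock v 0‖) : v ∈ cone (Fin.castAdd l 0) ε := by
  intro j
  refine Fin.addCases (fun i hi => ?_) (fun i _ => ?_) j
  · exact h₂ i fun h => hi (by rw [h])
  · exact h₁ i

lemma mem_cone_natAdd [NeZero l] {v : Fin (k + l) → ℍ[ℝ]} {ε : ℝ}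
    (h₁ : ∀ i, ‖fstBlock v i‖ ≤ ε * ‖sndBlock v 0‖)
    (h₂ : ∀ i ≠ 0, ‖sndBlock v i‖ ≤ ε * ‖sndBlock v 0‖) : v ∈ cone (Fin.natAdd k 0) ε := by
  intro j
  refine Fin.addCases (fun i _ => ?_) (fun i hi => ?_) j
  · exact h₁ i
  · exact h₂ i fun h => hi (by rw [h])

@[simp] lemma fstBlock_flow (x y : ℍ[ℝ]) (n : ℤ) (v : Fin (k + l) → ℍ[ℝ]) :
    fstBlock (flow x y n v) = x ^ n • jpow n (fstBlock v) := funext fun i => flow_castAdd x y n v i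

@[simp] lemma sndBlock_flow (x y : ℍ[ℝ]) (n : ℤ) (v : Fin (k + l) → ℍ[ℝ]) :
    sndBlock (flow x y n v) = y ^ n • jpow n (sndBlock v) := funext fun i => flow_natAdd x y n v i

section Flow

variable [NeZero k] [NeZero l] {x y : ℍ[ℝ]}

omit [NeZero k] in
lemma eventually_flow_atTop (hxy : ‖x‖ < ‖y‖) {F : Filter (Fin (k + l) → ℍ[ℝ])}
    {v : Fin (k + l) → ℍ[ℝ]} (hF : F ≤ 𝓝 v) (j : Fin l) (hj : sndBlock v j ≠ 0)
    (hFj : ∀ᶠ w in F, ∀ r > j, sndBlock w r = 0) {ε : ℝ} (hε : 0 < ε) :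
    ∀ᶠ z in atTop ×ˢ F, flow x y z.1 z.2 ∈ cone (Fin.natAdd k 0) ε := by
  have hy : y ≠ 0 := norm_pos_iff.1 ((norm_nonneg x).trans_lt hxy)
  filter_upwards [eventually_attracted atTop_le_cofinite_int (fun n => zpow_ne_zero n hy)
    (tendsto_zpow_ratio_atTop hxy) ((continuous_fstBlock.tendsto v).mono_left hF)
    ((continuous_sndBlock.tendsto v).mono_left hF) j hj hFj hε] with z hz
  exact mem_cone_natAdd (by simpa using hz.1) (by simpa using hz.2)

omit [NeZero l] in
lemma eventually_flow_atBot (hx : x ≠ 0) (hxy : ‖x‖ < ‖y‖) {F : Filter (Fin (k + l) → ℍ[ℝ])}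
    {v : Fin (k + l) → ℍ[ℝ]} (hF : F ≤ 𝓝 v) (j : Fin k) (hj : fstBlock v j ≠ 0)
    (hFj : ∀ᶠ w in F, ∀ r > j, fstBlock w r = 0) {ε : ℝ} (hε : 0 < ε) :
    ∀ᶠ z in atBot ×ˢ F, flow x y z.1 z.2 ∈ cone (Fin.castAdd l 0) ε := by
  filter_upwards [eventually_attracted atBot_le_cofinite_int (fun n => zpow_ne_zero n hx)
    (tendsto_zpow_ratio_atBot hx hxy) ((continuous_sndBlock.tendsto v).mono_left hF)
    ((continuous_fstBlock.tendsto v).mono_left hF) j hj hFj hε] with z hz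
  exact mem_cone_castAdd (by simpa using hz.1) (by simpa using hz.2)

omit [NeZero k] in
lemma eventually_orbit_atTop (hxy : ‖x‖ < ‖y‖) {v : Fin (k + l) → ℍ[ℝ]} (hv : sndBlock v ≠ 0)
    {ε : ℝ} (hε : 0 < ε) : ∀ᶠ n in atTop, flow x y n v ∈ cone (Fin.natAdd k 0) ε := by
  obtain ⟨j, hj, hr⟩ := exists_last_ne_zero hv
  have h := eventually_flow_atTop hxy (pure_le_nhds v) j hj (eventually_pure.2 hr) hε
  rwa [prod_pure, eventually_map] at h

omit [NeZero l] in
lemma eventually_orbit_atBot (hx : x ≠ 0) (hxy : ‖x‖ < ‖y‖) {v : Fin (k + l) → ℍ[ℝ]}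
    (hv : fstBlock v ≠ 0) {ε : ℝ} (hε : 0 < ε) :
    ∀ᶠ n in atBot, flow x y n v ∈ cone (Fin.castAdd l 0) ε := by
  obtain ⟨j, hj, hr⟩ := exists_last_ne_zero hv
  have h := eventually_flow_atBot hx hxy (pure_le_nhds v) j hj (eventually_pure.2 hr) hε
  rwa [prod_pure, eventually_map] at h

lemma eventually_orbit_of_sndBlock_eq_zero (hx : x ≠ 0) {v : Fin (k + l) → ℍ[ℝ]}
    (hv : fstBlock v ≠ 0) (hv' : sndBlock v = 0) {ε : ℝ} (hε : 0 < ε) :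
    ∀ᶠ n in cofinite, flow x y n v ∈ cone (Fin.castAdd l 0) ε := by
  obtain ⟨j, hj, hr⟩ := exists_last_ne_zero hv
  -- With `s = 0` the domination hypothesis is trivial, so the attraction holds along all of
  -- `cofinite`, even though this block has the smaller eigenvalue.
  have h := eventually_attracted (F := pure v) le_rfl (s := 0) (fun n => zpow_ne_zero n hx)
    (by simp) (tendsto_const_nhds (x := (0 : Fin l → ℍ[ℝ])))
    ((continuous_fstBlock.tendsto v).mono_left (pure_le_nhds v)) j hj (eventually_pure.2 hr) hε
  rw [prod_pure, eventually_map] at h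
  filter_upwards [h] with n hn
  exact mem_cone_castAdd (by simpa [hv', jpow_zero_right] using hn.1) (by simpa using hn.2)

lemma eventually_orbit_of_fstBlock_eq_zero (hy : y ≠ 0) {v : Fin (k + l) → ℍ[ℝ]}
    (hv : sndBlock v ≠ 0) (hv' : fstBlock v = 0) {ε : ℝ} (hε : 0 < ε) :
    ∀ᶠ n in cofinite, flow x y n v ∈ cone (Fin.natAdd k 0) ε := by
  obtain ⟨j, hj, hr⟩ := exists_last_ne_zero hv
  have h := eventually_attracted (F := pure v) le_rfl (s := 0) (fun n => zpow_ne_zero n hy)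
    (by simp) (tendsto_const_nhds (x := (0 : Fin k → ℍ[ℝ])))
    ((continuous_sndBlock.tendsto v).mono_left (pure_le_nhds v)) j hj (eventually_pure.2 hr) hε
  rw [prod_pure, eventually_map] at h
  filter_upwards [h] with n hn
  exact mem_cone_natAdd (by simpa [hv', jpow_zero_right] using hn.1) (by simpa using hn.2)

lemma eventually_orbit (hx : x ≠ 0) (hxy : ‖x‖ < ‖y‖) {v : Fin (k + l) → ℍ[ℝ]} (hv : v ≠ 0)
    {ε : ℝ} (hε : 0 < ε) : ∀ᶠ n in cofinite,
      flow x y n v ∈ cone (Fin.castAdd l 0) ε ∨ flow x y n v ∈ cone (Fin.natAdd k 0) ε := by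
  have hy : y ≠ 0 := norm_pos_iff.1 ((norm_nonneg x).trans_lt hxy)
  by_cases h₁ : fstBlock v = 0
  · have h₂ : sndBlock v ≠ 0 := fun h₂ => hv <| funext fun i =>
      Fin.addCases (fun i => congrFun h₁ i) (fun i => congrFun h₂ i) i
    exact (eventually_orbit_of_fstBlock_eq_zero hy h₂ h₁ hε).mono fun _ => Or.inr
  by_cases h₂ : sndBlock v = 0
  · exact (eventually_orbit_of_sndBlock_eq_zero hx h₁ h₂ hε).mono fun _ => Or.inl
  rw [Int.cofinite_eq, eventually_sup]
  exact ⟨(eventually_orbit_atBot hx hxy h₁ hε).mono fun _ => Or.inl,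
    (eventually_orbit_atTop hxy h₂ hε).mono fun _ => Or.inr⟩

/-- Because `i` and `j` are the last indices, no entries beyond them have to vanish, and the
attraction is uniform on a full neighbourhood of `v`. -/
lemma eventually_flow_nhds (hx : x ≠ 0) (hxy : ‖x‖ < ‖y‖) {v : Fin (k + l) → ℍ[ℝ]}
    {i : Fin k} (hi : (i : ℕ) + 1 = k) (hvi : fstBlock v i ≠ 0)
    {j : Fin l} (hj : (j : ℕ) + 1 = l) (hvj : sndBlock v j ≠ 0) {ε : ℝ} (hε : 0 < ε) :
    ∀ᶠ z in cofinite ×ˢ 𝓝 v,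
      flow x y z.1 z.2 ∈ cone (Fin.castAdd l 0) ε ∨ flow x y z.1 z.2 ∈ cone (Fin.natAdd k 0) ε := by
  rw [Int.cofinite_eq, sup_prod, eventually_sup]
  constructor
  · exact (eventually_flow_atBot hx hxy le_rfl i hvi (Eventually.of_forall fun w r hr =>
      absurd (Fin.lt_def.1 hr) (by have := r.2; omega)) hε).mono fun _ => Or.inl
  · exact (eventually_flow_atTop hxy le_rfl j hvj (Eventually.of_forall fun w r hr =>
      absurd (Fin.lt_def.1 hr) (by have := r.2; omega)) hε).mono fun _ => Or.inr

end Flow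

lemma exists_mk_mem_nhds {n : ℕ} {v : Fin n → ℍ[ℝ]} (hv : v ≠ 0) {N : Set (HP n)}
    (hN : N ∈ 𝓝 (Projectivization.mk ℍ[ℝ]ᵐᵒᵖ v hv)) :
    ∀ᶠ w in 𝓝 v, ∃ hw : w ≠ 0, Projectivization.mk ℍ[ℝ]ᵐᵒᵖ w hw ∈ N := by
  have h := continuous_mk.continuousAt (x := ⟨v, hv⟩) hN
  have h' := isOpen_ne.isOpenMap_subtype_val.image_mem_nhds h
  filter_upwards [h']
  rintro _ ⟨⟨w, hw⟩, h, rfl⟩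
  exact ⟨hw, h⟩

lemma eq_e_or_eq_e {n : ℕ} {i j : Fin n} {p : HP n}
    (h : ∀ ε > 0, p ∈ projSet (cone i ε) ∪ projSet (cone j ε)) : p = e i ∨ p = e j := by
  by_contra! hne
  obtain ⟨ε, hε, hi⟩ : ∃ ε > 0, p ∉ projSet (cone i ε) := by
    by_contra! h'
    exact hne.1 (eq_e_of_forall_mem_cone h')
  obtain ⟨δ, hδ, hj⟩ : ∃ ε > 0, p ∉ projSet (cone j ε) := by
    by_contra! h'
    exact hne.2 (eq_e_of_forall_mem_cone h')
  rcases h (min ε δ) (lt_min hε hδ) with h | h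
  · exact hi (cone_mono i (min_le_left _ _) h)
  · exact hj (cone_mono j (min_le_right _ _) h)

lemma e_mem_projSet_cone {n : ℕ} (i : Fin n) {ε : ℝ} (hε : 0 ≤ ε) : e i ∈ projSet (cone i ε) := by
  refine ((isHomogeneous_cone i _).mk_mem_projSet _).2 fun j hj => ?_
  simp [hj, hε]

lemma castAdd_ne_natAdd {k l : ℕ} (i : Fin k) (j : Fin l) : Fin.castAdd l i ≠ Fin.natAdd k j := by
  intro h
  have := congrArg Fin.val h
  rw [Fin.val_castAdd, Fin.val_natAdd] at this
  omega

@[simp] lemma fstBlock_single_natAdd {k l : ℕ} (i : Fin l) (a : ℍ[ℝ]) :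
    fstBlock (Pi.single (Fin.natAdd k i) a) = 0 := by
  ext1 j
  rw [fstBlock, Pi.single_eq_of_ne (castAdd_ne_natAdd j i), Pi.zero_apply]

@[simp] lemma sndBlock_single_castAdd {k l : ℕ} (i : Fin k) (a : ℍ[ℝ]) :
    sndBlock (Pi.single (Fin.castAdd l i) a) = 0 := by
  ext1 j
  rw [sndBlock, Pi.single_eq_of_ne (castAdd_ne_natAdd i j).symm, Pi.zero_apply]

/-! ### The Kulkarni sets of a cyclic group acting as the flow -/

section Limit

variable {k l : ℕ} [NeZero k] [NeZero l] {x y : ℍ[ℝ]} {g : PSL (k + l)}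

/-- `g` acts on the projective space as the flow. -/
def ActsAsFlow (x y : ℍ[ℝ]) (g : PSL (k + l)) : Prop :=
  ∀ (n : ℤ) (v : Fin (k + l) → ℍ[ℝ]) (hv : v ≠ 0), ∃ hw : flow x y n v ≠ 0,
    g ^ n • Projectivization.mk ℍ[ℝ]ᵐᵒᵖ v hv = Projectivization.mk ℍ[ℝ]ᵐᵒᵖ (flow x y n v) hw

omit [NeZero k] [NeZero l] in
lemma ActsAsFlow.smul_mem_projSet_iff (hg : ActsAsFlow x y g) {Q : Set (Fin (k + l) → ℍ[ℝ])}
    (hQ : IsHomogeneous Q) (n : ℤ) {v : Fin (k + l) → ℍ[ℝ]} (hv : v ≠ 0) :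
    g ^ n • Projectivization.mk ℍ[ℝ]ᵐᵒᵖ v hv ∈ projSet Q ↔ flow x y n v ∈ Q := by
  obtain ⟨hw, h⟩ := hg n v hv
  rw [h, hQ.mk_mem_projSet]

lemma ActsAsFlow.eventually_mem (hg : ActsAsFlow x y g) (hx : x ≠ 0) (hxy : ‖x‖ < ‖y‖)
    (p : HP (k + l)) {ε : ℝ} (hε : 0 < ε) : ∀ᶠ n : ℤ in cofinite,
      g ^ n • p ∈ projSet (cone (Fin.castAdd l 0) ε) ∪ projSet (cone (Fin.natAdd k 0) ε) := by
  induction p using Projectivization.ind with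
  | h v hv =>
    filter_upwards [eventually_orbit hx hxy hv hε] with n hn
    exact hn.imp (hg.smul_mem_projSet_iff (isHomogeneous_cone _ _) n hv).2
      (hg.smul_mem_projSet_iff (isHomogeneous_cone _ _) n hv).2

/-- The point equals its own translates by `g ^ (n * m)` for all `m`, and these exponents leave
every finite set, so it lies in every pair of cones. -/
lemma ActsAsFlow.eq_of_zpow_smul_eq (hg : ActsAsFlow x y g) (hx : x ≠ 0) (hxy : ‖x‖ < ‖y‖)
    {p : HP (k + l)} {n : ℤ} (hn : n ≠ 0) (h : g ^ n • p = p) :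
    p = e (Fin.castAdd l 0) ∨ p = e (Fin.natAdd k 0) := by
  have hfix : ∀ m : ℤ, g ^ (n * m) • p = p := fun m => by
    rw [zpow_mul]
    exact zpow_mem (K := MulAction.stabilizer (PSL (k + l)) p) (x := g ^ n) h m
  refine eq_e_or_eq_e fun ε hε => ?_
  obtain ⟨m, hm⟩ := (((mul_right_injective₀ hn).tendsto_cofinite).eventually
    (hg.eventually_mem hx hxy p hε)).exists
  rwa [hfix] at hm

omit [NeZero l] in
lemma ActsAsFlow.smul_e_castAdd (hg : ActsAsFlow x y g) (n : ℤ) :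
    g ^ n • (e (Fin.castAdd l 0) : HP (k + l)) = e (Fin.castAdd l 0) := by
  refine eq_e_of_forall_mem_cone fun ε hε => cone_mono _ hε.le
    ((hg.smul_mem_projSet_iff (isHomogeneous_cone _ _) n _).2 (mem_cone_castAdd ?_ ?_))
  · intro i
    simp [jpow_zero_right]
  · intro i hi
    simp only [fstBlock_flow, Pi.smul_apply, jpow]
    rw [Finset.sum_eq_zero]
    · simp
    · intro j _
      by_cases hj : j = 0
      · subst hj
        rw [if_neg fun h => hi (by simpa using h), zero_smul]
      · simp [fstBlock, hj]

omit [NeZero k] in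
lemma ActsAsFlow.smul_e_natAdd (hg : ActsAsFlow x y g) (n : ℤ) :
    g ^ n • (e (Fin.natAdd k 0) : HP (k + l)) = e (Fin.natAdd k 0) := by
  refine eq_e_of_forall_mem_cone fun ε hε => cone_mono _ hε.le
    ((hg.smul_mem_projSet_iff (isHomogeneous_cone _ _) n _).2 (mem_cone_natAdd ?_ ?_))
  · intro i
    simp [jpow_zero_right]
  · intro i hi
    simp only [sndBlock_flow, Pi.smul_apply, jpow]
    rw [Finset.sum_eq_zero]
    · simp
    · intro j _
      by_cases hj : j = 0
      · subst hj
        rw [if_neg fun h => hi (by simpa using h), zero_smul]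
      · simp [sndBlock, hj]

/-- A vector with nonzero entries in both blocks. -/
def diagVec (k l : ℕ) [NeZero k] [NeZero l] : Fin (k + l) → ℍ[ℝ] :=
  Fin.append (Pi.single 0 1) (Pi.single 0 1)

lemma fstBlock_diagVec_ne_zero : fstBlock (diagVec k l) ≠ 0 := fun h => by
  simpa [fstBlock, diagVec] using congrFun h 0

lemma sndBlock_diagVec_ne_zero : sndBlock (diagVec k l) ≠ 0 := fun h => by
  simpa [sndBlock, diagVec] using congrFun h 0

lemma diagVec_ne_zero : diagVec k l ≠ 0 := fun h =>
  fstBlock_diagVec_ne_zero (k := k) (l := l) (by rw [h]; rfl)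

lemma mk_diagVec_ne_castAdd :
    Projectivization.mk ℍ[ℝ]ᵐᵒᵖ (diagVec k l) diagVec_ne_zero ≠ e (Fin.castAdd l 0) := by
  intro h
  have h' := e_mem_projSet_cone (Fin.castAdd l (0 : Fin k)) le_rfl
  rw [← h, (isHomogeneous_cone _ _).mk_mem_projSet] at h'
  have h'' := h' (Fin.natAdd k 0) (castAdd_ne_natAdd _ _).symm
  norm_num [diagVec] at h''

lemma mk_diagVec_ne_natAdd :
    Projectivization.mk ℍ[ℝ]ᵐᵒᵖ (diagVec k l) diagVec_ne_zero ≠ e (Fin.natAdd k 0) := by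
  intro h
  have h' := e_mem_projSet_cone (Fin.natAdd k (0 : Fin l)) le_rfl
  rw [← h, (isHomogeneous_cone _ _).mk_mem_projSet] at h'
  have h'' := h' (Fin.castAdd l 0) (castAdd_ne_natAdd _ _)
  norm_num [diagVec] at h''

/-- A trivial nonzero power would fix the class of `diagVec`, which is neither of the two possible
fixed points. -/
lemma ActsAsFlow.zpow_injective (hg : ActsAsFlow x y g) (hx : x ≠ 0) (hxy : ‖x‖ < ‖y‖) :
    Function.Injective fun n : ℤ => g ^ n := by
  intro a b hab
  by_contra hne
  have h1 : g ^ (a - b) = 1 := by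
    rw [zpow_sub, mul_inv_eq_one]; exact hab
  rcases hg.eq_of_zpow_smul_eq hx hxy (p := Projectivization.mk _ (diagVec k l) diagVec_ne_zero)
    (sub_ne_zero.2 hne) (by rw [h1, one_smul]) with h | h
  · exact mk_diagVec_ne_castAdd h
  · exact mk_diagVec_ne_natAdd h

lemma isClosed_pair_e {n : ℕ} (i j : Fin n) : IsClosed ({e i, e j} : Set (HP n)) :=
  (isClosed_singleton_e i).union (isClosed_singleton_e j)

theorem kulkarniL0_eq (hg : ActsAsFlow x y g) (hx : x ≠ 0) (hxy : ‖x‖ < ‖y‖) :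
    kulkarniL0 (Subgroup.zpowers g) (HP (k + l)) =
      {e (Fin.castAdd l 0), e (Fin.natAdd k 0)} := by
  have hinj := hg.zpow_injective hx hxy
  rw [kulkarniL0, ← (isClosed_pair_e _ _).closure_eq]
  congr 1
  ext p
  have key : Infinite (MulAction.stabilizer (Subgroup.zpowers g) p) ↔
      ∃ᶠ n : ℤ in cofinite, g ^ n • p = p := by
    exact Set.infinite_coe_iff.trans (infinite_zpowers_setOf_iff hinj fun b => b • p = p)
  rw [Set.mem_ofPred_eq, key]
  constructor
  · intro h
    obtain ⟨n, hn, hn'⟩ := (h.and_eventually (eventually_cofinite_ne 0)).exists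
    exact hg.eq_of_zpow_smul_eq hx hxy hn' hn
  · rintro (rfl | rfl)
    · exact (Eventually.of_forall hg.smul_e_castAdd).frequently
    · exact (Eventually.of_forall hg.smul_e_natAdd).frequently

omit [NeZero k] [NeZero l] in
lemma isFamilyClusterPt_zpowers_iff (hinj : Function.Injective fun n : ℤ => g ^ n)
    (K : Set (HP (k + l))) (p : HP (k + l)) :
    IsFamilyClusterPt (fun b : Subgroup.zpowers g => b • K) p ↔
      ∀ N ∈ 𝓝 p, ∃ᶠ n : ℤ in cofinite, ∃ q ∈ K, g ^ n • q ∈ N := by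
  refine forall₂_congr fun N _ => ?_
  rw [infinite_zpowers_setOf_iff hinj fun b => (N ∩ b • K).Nonempty]
  refine frequently_congr (Eventually.of_forall fun n => ?_)
  constructor
  · rintro ⟨_, hN, q, hq, rfl⟩
    exact ⟨q, hq, hN⟩
  · rintro ⟨q, hq, hN⟩
    exact ⟨_, hN, q, hq, rfl⟩

theorem kulkarniL1_eq (hg : ActsAsFlow x y g) (hx : x ≠ 0) (hxy : ‖x‖ < ‖y‖) :
    kulkarniL1 (Subgroup.zpowers g) (HP (k + l)) =
      {e (Fin.castAdd l 0), e (Fin.natAdd k 0)} := by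
  have hinj := hg.zpow_injective hx hxy
  rw [kulkarniL1, ← (isClosed_pair_e _ _).closure_eq]
  congr 1
  ext p
  have hcl : ∀ q : HP (k + l), IsFamilyClusterPt
      (fun b : Subgroup.zpowers g => ({b • q} : Set (HP (k + l)))) p ↔
      ∀ N ∈ 𝓝 p, ∃ᶠ n : ℤ in cofinite, g ^ n • q ∈ N := fun q => by
    simpa using isFamilyClusterPt_zpowers_iff hinj {q} p
  simp only [Set.mem_ofPred_eq, hcl, kulkarniL0_eq hg hx hxy]
  constructor
  · rintro ⟨q, -, hq⟩
    refine eq_e_or_eq_e fun ε hε => ?_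
    by_contra hp
    have hN := ((isClosed_projSet_cone (Fin.castAdd l (0 : Fin k)) ε).union
      (isClosed_projSet_cone (Fin.natAdd k (0 : Fin l)) ε)).isOpen_compl.mem_nhds hp
    obtain ⟨n, hn, hn'⟩ := ((hq _ hN).and_eventually (hg.eventually_mem hx hxy q hε)).exists
    exact hn hn'
  · intro hp
    -- Both blocks of `diagVec` are nonzero, so its single orbit accumulates at both fixed points,
    -- one at each end of `ℤ`.
    refine ⟨Projectivization.mk _ (diagVec k l) diagVec_ne_zero, ?_, fun N hN => ?_⟩
    · rintro (h | h)
      · exact mk_diagVec_ne_castAdd h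
      · exact mk_diagVec_ne_natAdd h
    · rcases hp with rfl | rfl
      · obtain ⟨ε, hε, hN⟩ := exists_projSet_cone_subset _ hN
        refine Frequently.filter_mono (Eventually.frequently ?_) atBot_le_cofinite_int
        filter_upwards [eventually_orbit_atBot hx hxy (fstBlock_diagVec_ne_zero (k := k) (l := l)) hε] with n hn
        exact hN ((hg.smul_mem_projSet_iff (isHomogeneous_cone _ _) n _).2 hn)
      · obtain ⟨ε, hε, hN⟩ := exists_projSet_cone_subset _ hN
        refine Frequently.filter_mono (Eventually.frequently ?_) atTop_le_cofinite_int
        filter_upwards [eventually_orbit_atTop hxy (sndBlock_diagVec_ne_zero (k := k) (l := l)) hε] with n hn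
        exact hN ((hg.smul_mem_projSet_iff (isHomogeneous_cone _ _) n _).2 hn)

lemma ActsAsFlow.mem_kulkarniL2 (hg : ActsAsFlow x y g) (hx : x ≠ 0) (hxy : ‖x‖ < ‖y‖)
    {ℓ : Filter ℤ} [ℓ.NeBot] (hℓ : ℓ ≤ cofinite) {v : Fin (k + l) → ℍ[ℝ]} (hv : v ≠ 0)
    {w : ℤ → Fin (k + l) → ℍ[ℝ]} (hw : Tendsto w ℓ (𝓝 v)) {Q : Set (Fin (k + l) → ℍ[ℝ])}
    (hQ : IsHomogeneous Q) (hQc : IsClosed Q) (hflow : ∀ᶠ n in ℓ, flow x y n (w n) ∈ Q)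
    (h₁ : Pi.single (Fin.castAdd l 0) 1 ∉ Q) (h₂ : Pi.single (Fin.natAdd k 0) 1 ∉ Q) :
    Projectivization.mk ℍ[ℝ]ᵐᵒᵖ v hv ∈ kulkarniL2 (Subgroup.zpowers g) (HP (k + l)) := by
  refine subset_closure ⟨projSet Q, (hQ.isClosed_projSet hQc).isCompact, ?_, ?_⟩
  · rw [kulkarniL0_eq hg hx hxy, kulkarniL1_eq hg hx hxy, Set.union_self]
    rintro _ hp (rfl | rfl)
    · exact h₁ ((hQ.mk_mem_projSet _).1 hp)
    · exact h₂ ((hQ.mk_mem_projSet _).1 hp)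
  · rw [isFamilyClusterPt_zpowers_iff (hg.zpow_injective hx hxy)]
    intro N hN
    -- `g ^ n` moves the class of `w n` into `K = projSet Q`, so `g ^ (-n) • K` contains that class,
    -- which tends to the class of `v`.
    refine (tendsto_neg_cofinite.mono_left hℓ).frequently (Eventually.frequently ?_)
    filter_upwards [hw.eventually (exists_mk_mem_nhds hv hN), hflow] with n ⟨hne, hn⟩ hn'
    refine ⟨_, (hg.smul_mem_projSet_iff hQ n hne).2 hn', ?_⟩
    rwa [zpow_neg, inv_smul_smul]

omit [NeZero k] [NeZero l] in
lemma tendsto_append {ℓ : Filter ℤ} {a : ℤ → Fin k → ℍ[ℝ]} {b : ℤ → Fin l → ℍ[ℝ]}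
    {v : Fin (k + l) → ℍ[ℝ]} (ha : Tendsto a ℓ (𝓝 (fstBlock v)))
    (hb : Tendsto b ℓ (𝓝 (sndBlock v))) : Tendsto (fun n => Fin.append (a n) (b n)) ℓ (𝓝 v) := by
  rw [tendsto_pi_nhds] at ha hb ⊢
  intro i
  refine Fin.addCases (fun i => ?_) (fun i => ?_) i
  · simpa [fstBlock] using ha i
  · simpa [sndBlock] using hb i

omit [NeZero k] [NeZero l] in
@[simp] lemma fstBlock_append (a : Fin k → ℍ[ℝ]) (b : Fin l → ℍ[ℝ]) :
    fstBlock (Fin.append a b) = a := by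
  ext1 i; simp [fstBlock]

omit [NeZero k] [NeZero l] in
@[simp] lemma sndBlock_append (a : Fin k → ℍ[ℝ]) (b : Fin l → ℍ[ℝ]) :
    sndBlock (Fin.append a b) = b := by
  ext1 i; simp [sndBlock]

lemma norm_smul_op {m : ℕ} (α : ℍ[ℝ]ᵐᵒᵖ) (a : Fin m → ℍ[ℝ]) : ‖α • a‖ = ‖a‖ * ‖α.unop‖ := by
  by_cases hα : α = 0
  · simp [hα]
  have hle : ∀ (α : ℍ[ℝ]ᵐᵒᵖ) (a : Fin m → ℍ[ℝ]), ‖α • a‖ ≤ ‖a‖ * ‖α.unop‖ := fun α a => by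
    refine (pi_norm_le_iff_of_nonneg (by positivity)).2 fun i => ?_
    rw [Pi.smul_apply, MulOpposite.smul_eq_mul_unop, norm_mul]
    exact mul_le_mul_of_nonneg_right (norm_le_pi_norm a i) (norm_nonneg _)
  refine le_antisymm (hle α a) ?_
  have h := hle α⁻¹ (α • a)
  have hpos : 0 < ‖α.unop‖ := norm_pos_iff.2 (by simpa using hα)
  rwa [inv_smul_smul₀ hα, MulOpposite.unop_inv, norm_inv, ← div_eq_mul_inv, le_div_iff₀ hpos] at h

/-- The first block dominates as `n → -∞`, so its last entry is perturbed there. The balance set `Q`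
misses both fixed points, since at each of them exactly one side of its equation vanishes. -/
lemma ActsAsFlow.mem_kulkarniL2_of_fstBlock (hg : ActsAsFlow x y g) (hx : x ≠ 0)
    (hxy : ‖x‖ < ‖y‖) {v : Fin (k + l) → ℍ[ℝ]} (hv : v ≠ 0) {i : Fin k} (hi : (i : ℕ) + 1 = k)
    (hvi : fstBlock v i = 0) :
    Projectivization.mk ℍ[ℝ]ᵐᵒᵖ v hv ∈ kulkarniL2 (Subgroup.zpowers g) (HP (k + l)) := by
  obtain ⟨c, hc, hc'⟩ := exists_balanced atBot_le_cofinite_int (fun n => zpow_ne_zero n hx)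
    (tendsto_zpow_ratio_atBot hx hxy) (fstBlock v) (sndBlock v) i hi hvi
  refine hg.mem_kulkarniL2 hx hxy atBot_le_cofinite_int hv
    (tendsto_append hc tendsto_const_nhds) (Q := {v | ‖fstBlock v 0‖ = ‖sndBlock v‖}) ?_ ?_ ?_ ?_ ?_
  · intro α _ w hw
    have hw' : ‖fstBlock w 0‖ = ‖sndBlock w‖ := hw
    change ‖w (Fin.castAdd l 0) * α.unop‖ = ‖α • sndBlock w‖
    rw [norm_smul_op, norm_mul, ← hw']; rfl
  · exact isClosed_eq ((continuous_apply 0).comp continuous_fstBlock).norm continuous_sndBlock.norm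
  · simpa using hc'
  · simp [fstBlock]
  · intro h
    have h' := norm_le_pi_norm (sndBlock (Pi.single (Fin.natAdd k 0) 1 : Fin (k + l) → ℍ[ℝ])) 0
    rw [← show _ = _ from h, fstBlock_single_natAdd, Pi.zero_apply] at h'
    norm_num [sndBlock] at h'

lemma ActsAsFlow.mem_kulkarniL2_of_sndBlock (hg : ActsAsFlow x y g) (hx : x ≠ 0)
    (hxy : ‖x‖ < ‖y‖) {v : Fin (k + l) → ℍ[ℝ]} (hv : v ≠ 0) {i : Fin l} (hi : (i : ℕ) + 1 = l)
    (hvi : sndBlock v i = 0) :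
    Projectivization.mk ℍ[ℝ]ᵐᵒᵖ v hv ∈ kulkarniL2 (Subgroup.zpowers g) (HP (k + l)) := by
  have hy : y ≠ 0 := norm_pos_iff.1 ((norm_nonneg x).trans_lt hxy)
  obtain ⟨c, hc, hc'⟩ := exists_balanced atTop_le_cofinite_int (fun n => zpow_ne_zero n hy)
    (tendsto_zpow_ratio_atTop hxy) (sndBlock v) (fstBlock v) i hi hvi
  refine hg.mem_kulkarniL2 hx hxy atTop_le_cofinite_int hv
    (tendsto_append tendsto_const_nhds hc) (Q := {v | ‖sndBlock v 0‖ = ‖fstBlock v‖}) ?_ ?_ ?_ ?_ ?_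
  · intro α _ w hw
    have hw' : ‖sndBlock w 0‖ = ‖fstBlock w‖ := hw
    change ‖w (Fin.natAdd k 0) * α.unop‖ = ‖α • fstBlock w‖
    rw [norm_smul_op, norm_mul, ← hw']; rfl
  · exact isClosed_eq ((continuous_apply 0).comp continuous_sndBlock).norm continuous_fstBlock.norm
  · simpa using hc'
  · intro h
    have h' := norm_le_pi_norm (fstBlock (Pi.single (Fin.castAdd l 0) 1 : Fin (k + l) → ℍ[ℝ])) 0
    rw [← show _ = _ from h, sndBlock_single_castAdd, Pi.zero_apply] at h'
    norm_num [fstBlock] at h'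
  · simp [sndBlock]

theorem kulkarniL2_eq (hg : ActsAsFlow x y g) (hx : x ≠ 0) (hxy : ‖x‖ < ‖y‖)
    {i : Fin k} (hi : (i : ℕ) + 1 = k) {j : Fin l} (hj : (j : ℕ) + 1 = l) :
    kulkarniL2 (Subgroup.zpowers g) (HP (k + l)) =
      projSet {v | v (Fin.castAdd l i) = 0} ∪ projSet {v | v (Fin.natAdd k j) = 0} := by
  refine subset_antisymm ?_ ?_
  · refine closure_minimal ?_ ((isClosed_coord_eq_zero _).union (isClosed_coord_eq_zero _))
    rintro p ⟨K, hK, hKL, hp⟩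
    rw [kulkarniL0_eq hg hx hxy, kulkarniL1_eq hg hx hxy, Set.union_self] at hKL
    rw [isFamilyClusterPt_zpowers_iff (hg.zpow_injective hx hxy)] at hp
    obtain ⟨ε₁, hε₁, hd₁⟩ := exists_disjoint_projSet_cone hK (Fin.castAdd l 0)
      fun h => hKL h (Or.inl rfl)
    obtain ⟨ε₂, hε₂, hd₂⟩ := exists_disjoint_projSet_cone hK (Fin.natAdd k 0)
      fun h => hKL h (Or.inr rfl)
    induction p using Projectivization.ind with
    | h v hv =>
      by_contra hnot
      rw [Set.mem_union, (isHomogeneous_coord_eq_zero _).mk_mem_projSet,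
        (isHomogeneous_coord_eq_zero _).mk_mem_projSet, not_or] at hnot
      -- One neighbourhood `R` of `v` serves almost all exponents: for these, the flow carries all
      -- of `R` into cones missing `K`.
      obtain ⟨P, hP, R, hR, hPR⟩ := eventually_prod_iff.1
        (eventually_flow_nhds hx hxy hi hnot.1 hj hnot.2 (lt_min hε₁ hε₂))
      have hN := isOpenMap_mk.image_mem_nhds (x := ⟨v, hv⟩)
        (continuous_subtype_val.continuousAt.preimage_mem_nhds hR)
      obtain ⟨n, ⟨q, hq, ⟨w, hw⟩, hRw, hqw⟩, hn⟩ :=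
        ((hp _ hN).and_eventually (tendsto_neg_cofinite.eventually hP)).exists
      -- The point `q ∈ K` comes back from `R` under the exponent `-n`, which forces it into one of
      -- the cones that `K` avoids.
      have hq' : q = g ^ (-n) • Projectivization.mk ℍ[ℝ]ᵐᵒᵖ w hw := by
        rw [zpow_neg, eq_inv_smul_iff]; exact hqw.symm
      rcases hPR hn hRw with h | h
      · refine Set.disjoint_left.1 hd₁ hq (cone_mono _ (min_le_left ε₁ ε₂) ?_)
        rw [hq']
        exact (hg.smul_mem_projSet_iff (isHomogeneous_cone _ _) _ hw).2 h
      · refine Set.disjoint_left.1 hd₂ hq (cone_mono _ (min_le_right ε₁ ε₂) ?_)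
        rw [hq']
        exact (hg.smul_mem_projSet_iff (isHomogeneous_cone _ _) _ hw).2 h
  · intro p hp
    induction p using Projectivization.ind with
    | h v hv =>
      rcases hp with hp | hp
      · exact hg.mem_kulkarniL2_of_fstBlock hx hxy hv hi
          (((isHomogeneous_coord_eq_zero _).mk_mem_projSet hv).1 hp)
      · exact hg.mem_kulkarniL2_of_sndBlock hx hxy hv hj
          (((isHomogeneous_coord_eq_zero _).mk_mem_projSet hv).1 hp)

end Limit

end QuaternionicKulkarni

end

open QuaternionicKulkarni in
theorem mainTheorem8 (k l : ℕ) (hk : 0 < k) (hl : 0 < l) (lam₁ lam₂ : ℍ[ℝ])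
    (hlam : ‖lam₁‖ < ‖lam₂‖) (γ : SL (k + l))
    (hγ : γ.mat = blockDiag (lam₁ • J 1 k) (lam₂ • J 1 l))
    (γt : PSL (k + l)) (hlift : (γ : PSL (k + l)) = γt) :
    kulkarniL0 (Subgroup.zpowers γt) (HP (k + l)) = {e ⟨0, Nat.add_pos_left hk l⟩, e ⟨k, Nat.lt_add_of_pos_right hl⟩} ∧
    kulkarniL1 (Subgroup.zpowers γt) (HP (k + l)) = {e ⟨0, Nat.add_pos_left hk l⟩, e ⟨k, Nat.lt_add_of_pos_right hl⟩} ∧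
    kulkarniL2 (Subgroup.zpowers γt) (HP (k + l)) =
      L {x | ∃ i : Fin (k + l), (i : ℕ) + 1 ≠ k ∧ x = e i} ∪
        L {x | ∃ i : Fin (k + l), (i : ℕ) + 1 ≠ k + l ∧ x = e i} ∧
    kulkarniLimitSet (Subgroup.zpowers γt) (HP (k + l)) =
      L {x | ∃ i : Fin (k + l), (i : ℕ) + 1 ≠ k ∧ x = e i} ∪
        L {x | ∃ i : Fin (k + l), (i : ℕ) + 1 ≠ k + l ∧ x = e i} := by
  have : NeZero k := ⟨hk.ne'⟩
  have : NeZero l := ⟨hl.ne'⟩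
  have hx : lam₁ ≠ 0 := SL.fst_ne_zero hγ
  have hy : lam₂ ≠ 0 := norm_pos_iff.1 ((norm_nonneg _).trans_lt hlam)
  have hg : ActsAsFlow lam₁ lam₂ γt := by
    subst hlift
    intro n v hv
    have h := SL.zpow_smul_eq_flow hx hy hγ n v
    have hw : flow lam₁ lam₂ n v ≠ 0 := h ▸ (smul_ne_zero_iff_ne _).2 hv
    refine ⟨hw, ?_⟩
    rw [← QuotientGroup.mk_zpow, PSL.mk_smul_mk]
    congr 1
  obtain ⟨i, hi⟩ : ∃ i : Fin k, (i : ℕ) + 1 = k := ⟨⟨k - 1, by omega⟩, Nat.sub_add_cancel hk⟩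
  obtain ⟨j, hj⟩ : ∃ j : Fin l, (j : ℕ) + 1 = l := ⟨⟨l - 1, by omega⟩, Nat.sub_add_cancel hl⟩
  have e₁ : (⟨0, Nat.add_pos_left hk l⟩ : Fin (k + l)) = Fin.castAdd l 0 := Fin.ext (by simp)
  have e₂ : (⟨k, Nat.lt_add_of_pos_right hl⟩ : Fin (k + l)) = Fin.natAdd k 0 := Fin.ext (by simp)
  have hL₁ : L {x | ∃ i : Fin (k + l), (i : ℕ) + 1 ≠ k ∧ x = e i} =
      projSet {v : Fin (k + l) → ℍ[ℝ] | v (Fin.castAdd l i) = 0} := by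
    rw [← L_eq_projSet]
    simp only [ne_eq, Fin.ext_iff, Fin.val_castAdd, ← Nat.succ_inj (b := (i : ℕ)), Nat.succ_eq_add_one, hi]
  have hL₂ : L {x | ∃ i : Fin (k + l), (i : ℕ) + 1 ≠ k + l ∧ x = e i} =
      projSet {v : Fin (k + l) → ℍ[ℝ] | v (Fin.natAdd k j) = 0} := by
    rw [← L_eq_projSet]
    simp only [ne_eq, Fin.ext_iff, Fin.val_natAdd, ← Nat.succ_inj (b := k + (j : ℕ)), Nat.succ_eq_add_one, add_assoc, hj]
  have h₀ := kulkarniL0_eq hg hx hlam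
  have h₁ := kulkarniL1_eq hg hx hlam
  have h₂ := kulkarniL2_eq hg hx hlam hi hj
  rw [e₁, e₂, hL₁, hL₂]
  refine ⟨h₀, h₁, h₂, ?_⟩
  rw [kulkarniLimitSet, h₀, h₁, h₂, Set.union_self, Set.union_eq_right]
  -- Each fixed point lies in the hyperplane attached to the other block, which also covers blocks
  -- of size one.
  rintro _ (rfl | rfl)
  · exact Or.inr (((isHomogeneous_coord_eq_zero _).mk_mem_projSet _).2
      (Pi.single_eq_of_ne (castAdd_ne_natAdd _ _).symm _))
  · exact Or.inl (((isHomogeneous_coord_eq_zero _).mk_mem_projSet _).2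
      (Pi.single_eq_of_ne (castAdd_ne_natAdd _ _) _))
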